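/- For an integer $n\ge 0$, let $p_{[1^13^1]}(n)$ denote the number of partitions of $n$ in which parts that are multiples of $3$ appear in two colors and all other parts appear in one color (with $p_{[1^13^1]}(0)=1$). Then, for every integer $n\ge 0$, $$p_{[1^13^1]}(25n+21)\equiv 0 \pmod 5 \qquad\text{and}\qquad p_{[1^13^1]}(625n+521)\equiv 0 \pmod{5^2}.$$ -/

import Mathlib

/-- A part of a coloured partition in which parts of size `m` are available in `c m` colours:
a size `m` together with one of the `c m` colours. -/
abbrev ColoredPart (c : ℕ → ℕ) : Type := Σ m : ℕ, Fin (c m)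

/-- The partitions of `n` in which parts of size `m` are available in `c m` colours: the finite
multisets of coloured parts of positive size whose sizes add up to `n`. (The order of the parts
is irrelevant, and copies of the same size with different colours are different parts.) -/
def coloredPartitions (c : ℕ → ℕ) (n : ℕ) : Set (Multiset (ColoredPart c)) :=
  {s | (∀ x ∈ s, 0 < x.1) ∧ (s.map Sigma.fst).sum = n}

/-- There are only finitely many coloured partitions of `n`, so counting them with `Set.ncard`
gives their true number. -/
theorem coloredPartitions_finite (c : ℕ → ℕ) (n : ℕ) : (coloredPartitions c n).Finite := by
  classical
  let t : Finset (ColoredPart c) := (Finset.range (n + 1)).sigma fun _ => Finset.univ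
  refine ((n • t.val).powerset.toFinset.finite_toSet).subset ?_
  rintro s ⟨hpos, hsum⟩
  have hcard : Multiset.card s ≤ n := by
    have h := Multiset.card_nsmul_le_sum (s := s.map Sigma.fst) (a := 1) (by
      intro x hx
      obtain ⟨y, hy, rfl⟩ := Multiset.mem_map.1 hx
      exact hpos y hy)
    simpa [hsum] using h
  simp only [Finset.mem_coe, Multiset.mem_toFinset, Multiset.mem_powerset]
  rw [Multiset.le_iff_count]
  intro a
  by_cases ha : a ∈ s
  · have hle : a.1 ≤ n := by
      rw [← hsum]
      exact Multiset.single_le_sum (fun _ _ => Nat.zero_le _) _ (Multiset.mem_map_of_mem _ ha)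
    have hat : a ∈ t.val := by
      rw [Finset.mem_val]
      simp only [t, Finset.mem_sigma, Finset.mem_range, Finset.mem_univ, and_true]
      omega
    rw [Multiset.count_nsmul, Multiset.count_eq_one_of_mem t.nodup hat]
    have := Multiset.count_le_card a s
    omega
  · rw [Multiset.count_eq_zero_of_notMem ha]
    exact Nat.zero_le _

/-- The number of colours of a part of size `m`: two if `m` is a multiple of `3`, one otherwise. -/
def colorsOneThree (m : ℕ) : ℕ := if 3 ∣ m then 2 else 1

/-- `p_{[1^1 3^1]}(n)`: the number of partitions of `n` in which multiples of `3` appear in two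
colours and the other parts in one colour. -/
noncomputable def pOneThree (n : ℕ) : ℕ := (coloredPartitions colorsOneThree n).ncard

/-! Write E for Euler's product ∏ (1 - X^n), P = 1/E, and f_k for f(X^k). The generating function is
P P_3, and `sect r` extracts the coefficients of index 5n + r. The claims become: `sect 4 (sect 1 (P
P_3))` equals 5G for some integral G, and `sect 4 (sect 0 G)` vanishes modulo 5.

The tool is Ramanujan's dissection E = E_25 (R_5 - X - X^2/R_5), with R the Rogers-Ramanujan
quotient `rrSeries`. Its norm over the fifth roots of unity is E^6 = E_5^6 (R^5 - 11X - X^2/R^5)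
(`pentagonalSeries_pow_six`). Together they give every section of P and of E^3 as a polynomial in R,
1/R and X times a common factor.

Products mixing X and X^3 also need an equation between R and R_3 (`rrSeries_relation`). It comes
from 3-cores: E_3^3/E counts lattice points on ellipses, and a homothety of ratio -5 shows that its
section 3 is X times itself at X^5. Dissecting E_3^3 P and comparing yields an equation with two
factors, one of which is visibly nonzero.

With this relation, `sect 1 (P P_3)` is X^2 P_5 M_3 + P_15 M + 5(...) modulo 25, where M = P^6
E_5^5. The first congruence holds because 5 divides `sect 4 (P ^ 6)`. Modulo 5, where f_5 = f^5, one
finds G = 2(X^2 E_3^23 P + E^23 P_3), and `sect 0 G` is twice `sect 1 (P P_3)`; so `sect 4` kills it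
for the same reason as before.

The Jacobi triple product, proved in finite form over any commutative ring, is used over dual
numbers (exponents of E^3) and over Laurent polynomials (3-cores). -/

open PowerSeries

/-! ### Extraction of arithmetic progressions modulo 5 -/

section Sections
set_option linter.unusedSimpArgs false
variable {R : Type*} [CommRing R]

/-- The substitution `X ↦ X ^ 5`. -/
noncomputable abbrev expand5 : R⟦X⟧ →ₐ[R] R⟦X⟧ := expand 5 (by norm_num)

/-- The substitution `X ↦ X ^ 3`. -/
noncomputable abbrev expand3 : R⟦X⟧ →ₐ[R] R⟦X⟧ := expand 3 (by norm_num)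

theorem expand5_expand3 (f : R⟦X⟧) : expand5 (expand3 f) = expand3 (expand5 f) := by
  rw [← expand_mul, ← expand_mul]

/-- The series `∑ f₅ₙ₊ᵣ Xⁿ`. -/
noncomputable def sect (r : ℕ) : R⟦X⟧ →ₗ[R] R⟦X⟧ where
  toFun f := mk fun n => coeff (5 * n + r) f
  map_add' f g := by ext; simp
  map_smul' c f := by ext; simp

@[simp]
theorem coeff_sect (r n : ℕ) (f : R⟦X⟧) : coeff n (sect r f) = coeff (5 * n + r) f := by
  simp [sect]

theorem sect_map {S : Type*} [CommRing S] (h : R →+* S) (r : ℕ) (f : R⟦X⟧) :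
    sect r (map h f) = map h (sect r f) := by
  ext; simp

theorem eq_of_sect_eq {f g : R⟦X⟧} (h : ∀ r < 5, sect r f = sect r g) : f = g := by
  ext n
  have := congrArg (coeff (n / 5)) (h (n % 5) (Nat.mod_lt _ (by norm_num)))
  simpa [Nat.div_add_mod] using this

/-- A series in X^5 contributes only exponents divisible by 5, so sections are linear over such
series. This is the rule by which factors in X^5 are pulled out everywhere below. -/
theorem sect_expand5_mul {r : ℕ} (hr : r < 5) (g f : R⟦X⟧) :
    sect r (expand5 g * f) = g * sect r f := by
  ext n
  rw [coeff_sect, coeff_mul, coeff_mul]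
  symm
  refine Finset.sum_of_injOn (fun p => (5 * p.1, 5 * p.2 + r)) ?_ ?_ ?_ ?_
  · rintro ⟨a, b⟩ _ ⟨c, d⟩ _ h
    simp only [Prod.mk.injEq] at h ⊢
    omega
  · rintro ⟨a, b⟩ h
    simp only [Finset.mem_coe, Finset.HasAntidiagonal.mem_antidiagonal] at h ⊢
    omega
  · rintro ⟨a, b⟩ h h'
    rw [Finset.HasAntidiagonal.mem_antidiagonal] at h
    dsimp only at h
    rw [coeff_expand_of_not_dvd, zero_mul]
    rintro ⟨c, rfl⟩
    apply h'
    refine ⟨(c, (b - r) / 5), ?_, ?_⟩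
    · simp only [Finset.mem_coe, Finset.HasAntidiagonal.mem_antidiagonal]
      omega
    · simp only [Prod.mk.injEq, true_and]
      omega
  · rintro ⟨a, b⟩ _
    simp

@[simp]
theorem sect_succ_X_mul (r : ℕ) (f : R⟦X⟧) : sect (r + 1) (X * f) = sect r f := by
  ext n
  rw [coeff_sect, coeff_sect, ← add_assoc, coeff_succ_X_mul]

@[simp]
theorem sect_zero_X_mul (f : R⟦X⟧) : sect 0 (X * f) = X * sect 4 f := by
  ext n
  cases n with
  | zero => simp
  | succ n =>
    rw [coeff_sect, coeff_succ_X_mul, coeff_sect,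
      show 5 * (n + 1) + 0 = (5 * n + 4) + 1 by ring, coeff_succ_X_mul]

theorem sect_one_X_mul (f : R⟦X⟧) : sect 1 (X * f) = sect 0 f := sect_succ_X_mul 0 f
theorem sect_two_X_mul (f : R⟦X⟧) : sect 2 (X * f) = sect 1 f := sect_succ_X_mul 1 f
theorem sect_three_X_mul (f : R⟦X⟧) : sect 3 (X * f) = sect 2 f := sect_succ_X_mul 2 f
theorem sect_four_X_mul (f : R⟦X⟧) : sect 4 (X * f) = sect 3 f := sect_succ_X_mul 3 f

theorem sect_zero_one : sect 0 (1 : R⟦X⟧) = 1 := by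
  ext n
  rw [coeff_sect, coeff_one, coeff_one]
  congr 1
  simp

theorem sect_one_of_pos {r : ℕ} (hr : 0 < r) : sect r (1 : R⟦X⟧) = 0 := by
  ext n
  rw [coeff_sect, coeff_one, if_neg (by omega), map_zero]

theorem sect_expand5_zero (g : R⟦X⟧) : sect 0 (expand5 g) = g := by
  rw [← mul_one (expand5 g), sect_expand5_mul (by norm_num), sect_zero_one, mul_one]

theorem sect_expand5_of_pos {r : ℕ} (hr : 0 < r) (hr' : r < 5) (g : R⟦X⟧) :
    sect r (expand5 g) = 0 := by
  rw [← mul_one (expand5 g), sect_expand5_mul hr', sect_one_of_pos hr, mul_zero]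

/-- Any series is recovered from its five sections. -/
theorem eq_sum_sect (f : R⟦X⟧) :
    f = expand5 (sect 0 f) + X * (expand5 (sect 1 f) + X * (expand5 (sect 2 f)
      + X * (expand5 (sect 3 f) + X * expand5 (sect 4 f)))) := by
  apply eq_of_sect_eq
  intro r hr
  interval_cases r <;>
  simp only [map_add, sect_zero_X_mul, sect_one_X_mul, sect_two_X_mul, sect_three_X_mul,
    sect_four_X_mul, sect_expand5_zero, sect_expand5_of_pos (zero_lt_one) (by norm_num : 1 < 5),
    sect_expand5_of_pos (zero_lt_two) (by norm_num : 2 < 5),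
    sect_expand5_of_pos (zero_lt_three) (by norm_num : 3 < 5),
    sect_expand5_of_pos (zero_lt_four) (by norm_num : 4 < 5), mul_zero, add_zero, zero_add]

theorem mul_eq_sum_sect (f g : R⟦X⟧) :
    f * g = expand5 (sect 0 f) * g + X * (expand5 (sect 1 f) * g + X * (expand5 (sect 2 f) * g
      + X * (expand5 (sect 3 f) * g + X * (expand5 (sect 4 f) * g)))) := by
  conv_lhs => rw [eq_sum_sect f]
  ring

variable (f g : R⟦X⟧)

theorem sect_zero_mul : sect 0 (f * g) = sect 0 f * sect 0 g + X * (sect 1 f * sect 4 g +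
    sect 2 f * sect 3 g + sect 3 f * sect 2 g + sect 4 f * sect 1 g) := by
  rw [mul_eq_sum_sect]
  simp [sect_one_X_mul, sect_two_X_mul, sect_three_X_mul, sect_four_X_mul, sect_expand5_mul]
  ring

theorem sect_one_mul : sect 1 (f * g) = sect 0 f * sect 1 g + sect 1 f * sect 0 g +
    X * (sect 2 f * sect 4 g + sect 3 f * sect 3 g + sect 4 f * sect 2 g) := by
  rw [mul_eq_sum_sect]
  simp [sect_one_X_mul, sect_two_X_mul, sect_three_X_mul, sect_four_X_mul, sect_expand5_mul]
  ring

theorem sect_two_mul : sect 2 (f * g) = sect 0 f * sect 2 g + sect 1 f * sect 1 g +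
    sect 2 f * sect 0 g + X * (sect 3 f * sect 4 g + sect 4 f * sect 3 g) := by
  rw [mul_eq_sum_sect]
  simp [sect_one_X_mul, sect_two_X_mul, sect_three_X_mul, sect_four_X_mul, sect_expand5_mul]
  ring

theorem sect_three_mul : sect 3 (f * g) = sect 0 f * sect 3 g + sect 1 f * sect 2 g +
    sect 2 f * sect 1 g + sect 3 f * sect 0 g + X * (sect 4 f * sect 4 g) := by
  rw [mul_eq_sum_sect]
  simp [sect_one_X_mul, sect_two_X_mul, sect_three_X_mul, sect_four_X_mul, sect_expand5_mul]
  ring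

/-- If `3 * r' = r + 5 * s`, then section `r` of `f (X ^ 3)` comes from section `r'` of `f`. -/
theorem sect_expand3 {r r' s : ℕ} (h : 3 * r' = r + 5 * s) (hs : s < 3) :
    sect r (expand3 f) = X ^ s * expand3 (sect r' f) := by
  ext n
  rw [coeff_sect, coeff_X_pow_mul', coeff_expand]
  split_ifs with h1 h2 h2
  · rw [coeff_expand, if_pos (by omega), coeff_sect]
    congr 2
    omega
  · omega
  · rw [coeff_expand, if_neg (by omega)]
  · rfl

theorem sect_zero_expand3 : sect 0 (expand3 f) = expand3 (sect 0 f) := by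
  simpa using sect_expand3 f (r := 0) (r' := 0) (s := 0) (by norm_num) (by norm_num)

theorem sect_one_expand3 : sect 1 (expand3 f) = X * expand3 (sect 2 f) := by
  simpa using sect_expand3 f (r := 1) (r' := 2) (s := 1) (by norm_num) (by norm_num)

theorem sect_two_expand3 : sect 2 (expand3 f) = X ^ 2 * expand3 (sect 4 f) :=
  sect_expand3 f (r := 2) (r' := 4) (s := 2) (by norm_num) (by norm_num)

theorem sect_three_expand3 : sect 3 (expand3 f) = expand3 (sect 1 f) := by
  simpa using sect_expand3 f (r := 3) (r' := 1) (s := 0) (by norm_num) (by norm_num)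

theorem sect_four_expand3 : sect 4 (expand3 f) = X * expand3 (sect 3 f) := by
  simpa using sect_expand3 f (r := 4) (r' := 3) (s := 1) (by norm_num) (by norm_num)

end Sections

instance : Fact (Nat.Prime 5) := ⟨by norm_num⟩

/-- Frobenius is the identity on the coefficients, so the fifth power only acts on X. -/
theorem expand5_zmod (f : (ZMod 5)⟦X⟧) : expand5 f = f ^ 5 := by
  have := MvPowerSeries.map_frobenius_expand 5 (by norm_num) (f := f)
  rw [ZMod.frobenius_zmod] at this
  rw [← this]
  change _ = map (RingHom.id (ZMod 5)) (expand5 f)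
  rw [map_id]
  rfl

/-! ### From coloured partitions to the product P(X) P(X^3) -/

section GeneratingFunction

/-- The product of the ordinary partition series and Euler's product is `1`. -/
theorem mk_card_partition_mul_pentagonalSeries :
    (mk fun n => (Fintype.card n.Partition : ℤ)) * pentagonalSeries ℤ = 1 := by
  let _ : TopologicalSpace ℤ := ⊥
  have : DiscreteTopology ℤ := ⟨rfl⟩
  open scoped PowerSeries.WithPiTopology in
  have h1 := Nat.Partition.hasProd_powerSeriesMk_card_restricted ℤ (fun _ => True)
  have h2 := WithPiTopology.hasProd_one_sub_X_pow ℤ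
  have h3 := h1.mul h2
  have h4 : (fun i : ℕ => (if True then ∑' j : ℕ, (X : ℤ⟦X⟧) ^ ((i + 1) * j) else 1) *
      (1 - X ^ (i + 1))) = fun _ => 1 := by
    funext i
    simp only [if_true, pow_mul]
    exact WithPiTopology.tsum_pow_mul_one_sub_of_constantCoeff_eq_zero (by simp)
  rw [h4] at h3
  have h5 := h3.unique hasProd_one
  rw [← h5]
  congr 2
  ext n
  simp [Nat.Partition.restricted]

theorem colorsOneThree_pos (m : ℕ) : 0 < colorsOneThree m := by
  unfold colorsOneThree; split_ifs <;> norm_num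

theorem one_lt_colorsOneThree (m : ℕ) : 1 < colorsOneThree (3 * m) := by
  simp [colorsOneThree]

/-- A part of the first colour. -/
def firstColor (m : ℕ) : ColoredPart colorsOneThree := ⟨m, ⟨0, colorsOneThree_pos m⟩⟩

/-- A part of size `3 * m` of the second colour. -/
def secondColor (m : ℕ) : ColoredPart colorsOneThree := ⟨3 * m, ⟨1, one_lt_colorsOneThree m⟩⟩

theorem firstColor_or_secondColor (x : ColoredPart colorsOneThree) :
    (x.2.1 = 0 ∧ x = firstColor x.1) ∨ (x.2.1 = 1 ∧ x = secondColor (x.1 / 3)) := by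
  obtain ⟨m, i, hi⟩ := x
  have hi' := hi
  unfold colorsOneThree at hi'
  split_ifs at hi' with h
  · obtain rfl | rfl : i = 0 ∨ i = 1 := by omega
    · exact Or.inl ⟨rfl, rfl⟩
    · obtain ⟨k, rfl⟩ := h
      refine Or.inr ⟨rfl, ?_⟩
      have : 3 * k / 3 = k := by omega
      simp only [this]
      rfl
  · obtain rfl : i = 0 := by omega
    exact Or.inl ⟨rfl, rfl⟩

/-- The coloured partition assembled from its two colour classes. -/
def joinColors (p : Multiset ℕ × Multiset ℕ) : Multiset (ColoredPart colorsOneThree) :=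
  p.1.map firstColor + p.2.map secondColor

theorem joinColors_injective : Function.Injective joinColors := by
  have h1 : ∀ p, ((joinColors p).filter (fun x => x.2.1 = 0)).map Sigma.fst = p.1 := by
    intro p
    simp [joinColors, Multiset.filter_add, Multiset.filter_map, firstColor, secondColor,
      Function.comp_def]
  have h2 : ∀ p, ((joinColors p).filter (fun x => x.2.1 = 1)).map (fun x => x.1 / 3) = p.2 := by
    intro p
    simp [joinColors, Multiset.filter_add, Multiset.filter_map, firstColor, secondColor,
      Function.comp_def]
  intro p p' h
  apply Prod.ext
  · rw [← h1 p, ← h1 p', h]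
  · rw [← h2 p, ← h2 p', h]

theorem joinColors_surjective : Function.Surjective joinColors := by
  intro s
  induction s using Multiset.induction with
  | empty => exact ⟨(0, 0), rfl⟩
  | cons x s ih =>
    obtain ⟨⟨u, v⟩, rfl⟩ := ih
    rcases firstColor_or_secondColor x with ⟨-, h⟩ | ⟨-, h⟩
    · refine ⟨(x.1 ::ₘ u, v), ?_⟩
      rw [joinColors, Multiset.map_cons, ← h, Multiset.cons_add]
      rfl
    · refine ⟨(u, (x.1 / 3) ::ₘ v), ?_⟩
      rw [joinColors, Multiset.map_cons, ← h, Multiset.add_cons]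
      rfl

theorem joinColors_mem_coloredPartitions (p : Multiset ℕ × Multiset ℕ) (n : ℕ) :
    joinColors p ∈ coloredPartitions colorsOneThree n ↔
      (∀ x ∈ p.1, 0 < x) ∧ (∀ x ∈ p.2, 0 < x) ∧ p.1.sum + 3 * p.2.sum = n := by
  have h : ((joinColors p).map Sigma.fst).sum = p.1.sum + 3 * p.2.sum := by
    simpa [joinColors, firstColor, secondColor, Function.comp_def] using
      Multiset.sum_map_mul_left (s := p.2) (a := 3) (f := fun x => x)
  rw [coloredPartitions, Set.mem_ofPred_eq, h, ← and_assoc]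
  refine and_congr_left fun _ => ?_
  simp only [joinColors, Multiset.mem_add, Multiset.mem_map]
  constructor
  · intro H
    refine ⟨fun x hx => H _ (Or.inl ⟨x, hx, rfl⟩), fun x hx => ?_⟩
    have := H _ (Or.inr ⟨x, hx, rfl⟩)
    simp only [secondColor] at this
    omega
  · rintro ⟨H1, H2⟩ x (⟨y, hy, rfl⟩ | ⟨y, hy, rfl⟩)
    · exact H1 y hy
    · have := H2 y hy
      simp only [secondColor]
      omega

/-- Splitting by colour gives two ordinary partitions, the second one scaled by 3. The component
`p.2` is the total size of the second colour, which is why only multiples of 3 occur. -/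
theorem pOneThree_eq_sum (n : ℕ) :
    pOneThree n = ∑ p ∈ (Finset.HasAntidiagonal.antidiagonal n).filter (fun p => 3 ∣ p.2),
      Fintype.card p.1.Partition * Fintype.card (p.2 / 3).Partition := by
  classical
  set T : Set (Multiset ℕ × Multiset ℕ) := {p | (∀ x ∈ p.1, 0 < x) ∧ (∀ x ∈ p.2, 0 < x) ∧
    p.1.sum + 3 * p.2.sum = n} with hT
  have h1 : coloredPartitions colorsOneThree n = joinColors '' T := by
    ext s
    obtain ⟨p, rfl⟩ := joinColors_surjective s
    rw [joinColors_mem_coloredPartitions, joinColors_injective.mem_set_image]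
    rfl
  rw [pOneThree, h1, Set.ncard_image_of_injective _ joinColors_injective, ← Nat.card_coe_set_eq]
  set A := (Finset.HasAntidiagonal.antidiagonal n).filter (fun p => 3 ∣ p.2) with hA
  have hmem : ∀ p ∈ A, p.1 + p.2 = n ∧ 3 ∣ p.2 := fun p hp => by
    rwa [hA, Finset.mem_filter, Finset.HasAntidiagonal.mem_antidiagonal] at hp
  let F : (Σ p : A, (p.1.1).Partition × (p.1.2 / 3).Partition) → T := fun x =>
    ⟨(x.2.1.parts, x.2.2.parts), fun _ h => x.2.1.parts_pos h, fun _ h => x.2.2.parts_pos h, by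
      have h := hmem x.1 x.1.2
      rw [x.2.1.parts_sum, x.2.2.parts_sum, Nat.mul_div_cancel' h.2, h.1]⟩
  have hF : Function.Bijective F := by
    constructor
    · rintro ⟨⟨⟨i, j⟩, hp⟩, u, v⟩ ⟨⟨⟨i', j'⟩, hp'⟩, u', v'⟩ h
      simp only [F, Subtype.mk.injEq, Prod.mk.injEq] at h
      obtain ⟨hu, hv⟩ := h
      have hi : i = i' := u.parts_sum.symm.trans (hu ▸ u'.parts_sum)
      have hj : j / 3 = j' / 3 := v.parts_sum.symm.trans (hv ▸ v'.parts_sum)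
      obtain rfl := hi
      obtain rfl : j = j' := by
        have := (hmem _ hp).1
        have := (hmem _ hp').1
        dsimp only at *
        omega
      obtain rfl := Nat.Partition.ext hu
      obtain rfl := Nat.Partition.ext hv
      rfl
    · rintro ⟨⟨u, v⟩, hu, hv, hs⟩
      have hv3 : (3 * v.sum) / 3 = v.sum := by omega
      refine ⟨⟨⟨(u.sum, 3 * v.sum), ?_⟩, ⟨u, fun h => hu _ h, rfl⟩, ⟨v, fun h => hv _ h, ?_⟩⟩, rfl⟩
      · rw [hA, Finset.mem_filter, Finset.HasAntidiagonal.mem_antidiagonal]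
        exact ⟨hs, dvd_mul_right _ _⟩
      · exact hv3.symm
  rw [← Nat.card_congr (Equiv.ofBijective F hF), Nat.card_eq_fintype_card, Fintype.card_sigma,
    Finset.sum_coe_sort A (fun p => Fintype.card (p.1.Partition × (p.2 / 3).Partition))]
  simp only [Fintype.card_prod]

theorem mk_pOneThree_eq :
    (mk fun n => (pOneThree n : ℤ)) = (mk fun n => (Fintype.card n.Partition : ℤ)) *
      expand3 (mk fun n => (Fintype.card n.Partition : ℤ)) := by
  ext n
  rw [coeff_mk, pOneThree_eq_sum, coeff_mul, Finset.sum_filter, Nat.cast_sum]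
  refine Finset.sum_congr rfl fun p _ => ?_
  rw [coeff_expand]
  split_ifs <;> simp

end GeneratingFunction

/-! ### Finite Jacobi triple product over a commutative ring -/

section TripleProduct
variable {R : Type*} [CommRing R]

/-- The Gaussian binomial coefficients, defined by a Pascal recurrence. -/
def qBinom (q : R) : ℕ → ℕ → R
  | _, 0 => 1
  | 0, _ + 1 => 0
  | n + 1, k + 1 => q ^ (k + 1) * qBinom q n (k + 1) + qBinom q n k

theorem qBinom_zero_right (q : R) (n : ℕ) : qBinom q n 0 = 1 := by
  cases n <;> rfl

theorem qBinom_succ_succ (q : R) (n k : ℕ) :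
    qBinom q (n + 1) (k + 1) = q ^ (k + 1) * qBinom q n (k + 1) + qBinom q n k := rfl

theorem qBinom_eq_zero (q : R) {n k : ℕ} (h : n < k) : qBinom q n k = 0 := by
  induction n generalizing k with
  | zero =>
    obtain ⟨k, rfl⟩ := Nat.exists_eq_succ_of_ne_zero h.ne'
    rfl
  | succ n ih =>
    obtain ⟨k, rfl⟩ := Nat.exists_eq_succ_of_ne_zero (Nat.ne_zero_of_lt h)
    rw [Nat.succ_eq_add_one, qBinom_succ_succ, ih (by omega), ih (by omega), mul_zero, add_zero]

theorem qBinom_self (q : R) (n : ℕ) : qBinom q n n = 1 := by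
  induction n with
  | zero => rfl
  | succ n ih => rw [qBinom_succ_succ, qBinom_eq_zero q n.lt_succ_self, ih, mul_zero, zero_add]

/-- The product `(1 - q) (1 - q²) ⋯ (1 - qⁿ)`. -/
def qFac (q : R) (n : ℕ) : R := ∏ i ∈ Finset.range n, (1 - q ^ (i + 1))

theorem qFac_succ (q : R) (n : ℕ) : qFac q (n + 1) = qFac q n * (1 - q ^ (n + 1)) :=
  Finset.prod_range_succ _ _

theorem qFac_map {S : Type*} [CommRing S] (h : R →+* S) (q : R) (n : ℕ) :
    h (qFac q n) = qFac (h q) n := by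
  simp [qFac]

/-- The quotient formula for Gaussian binomials, kept free of division because the factors need not
be invertible in `R`. -/
theorem qBinom_mul_qFac (q : R) (a b : ℕ) :
    qBinom q (a + b) a * (qFac q a * qFac q b) = qFac q (a + b) := by
  induction h : a + b generalizing a b with
  | zero =>
    obtain ⟨rfl, rfl⟩ : a = 0 ∧ b = 0 := by omega
    simp [qBinom_zero_right, qFac]
  | succ n ih =>
    cases a with
    | zero =>
      obtain rfl : b = n + 1 := by omega
      simp [qBinom_zero_right, qFac]
    | succ a =>
      cases b with
      | zero =>
        obtain rfl : a = n := by omega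
        simp [qBinom_self, qFac]
      | succ b =>
        have h1 := ih (a + 1) b (by omega)
        have h2 := ih a (b + 1) (by omega)
        obtain rfl : n = a + b + 1 := by omega
        rw [qBinom_succ_succ, qFac_succ q (a + b + 1)]
        rw [qFac_succ] at h1 h2 ⊢
        rw [qFac_succ q b]
        linear_combination q ^ (a + 1) * (1 - q ^ (b + 1)) * h1 + (1 - q ^ (a + 1)) * h2

/-- The q-binomial theorem. It is homogeneous in `y` and `z` so that y = q^n can be inserted later
without negative powers of q. The induction splits off the factor i = 0 and replaces z by zq. -/
theorem prod_add_mul_pow (q y z : R) (n : ℕ) :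
    ∏ i ∈ Finset.range n, (y + z * q ^ i) =
      ∑ j ∈ Finset.range (n + 1), qBinom q n j * q ^ (j.choose 2) * z ^ j * y ^ (n - j) := by
  induction n generalizing z with
  | zero => simp [qBinom_zero_right]
  | succ n ih =>
    rw [Finset.prod_range_succ']
    have h : ∀ i, y + z * q ^ (i + 1) = y + z * q * q ^ i := fun i => by ring
    simp only [h]
    rw [ih (z * q), pow_zero, mul_one, mul_add, Finset.sum_range_succ' _ (n + 1)]
    have e1 : (∑ j ∈ Finset.range (n + 1),
        qBinom q n j * q ^ (j.choose 2) * (z * q) ^ j * y ^ (n - j)) * y =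
        (∑ j ∈ Finset.range (n + 1), q ^ (j + 1) * qBinom q n (j + 1) *
          q ^ ((j + 1).choose 2) * z ^ (j + 1) * y ^ (n - j)) + y ^ (n + 1) := by
      rw [Finset.sum_range_succ', Finset.sum_range_succ, qBinom_eq_zero q n.lt_succ_self, add_mul,
        Finset.sum_mul]
      simp only [qBinom_zero_right, Nat.choose_zero_succ, pow_zero, Nat.sub_zero, mul_zero,
        zero_mul, add_zero, one_mul]
      rw [← pow_succ]
      congr 1
      refine Finset.sum_congr rfl fun j hj => ?_
      rw [show n - j = n - (j + 1) + 1 by have := Finset.mem_range.1 hj; omega]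
      ring
    have e2 : (∑ j ∈ Finset.range (n + 1),
        qBinom q n j * q ^ (j.choose 2) * (z * q) ^ j * y ^ (n - j)) * z =
        ∑ j ∈ Finset.range (n + 1), qBinom q n j *
          q ^ ((j + 1).choose 2) * z ^ (j + 1) * y ^ (n - j) := by
      rw [Finset.sum_mul]
      refine Finset.sum_congr rfl fun j _ => ?_
      rw [Nat.choose_succ_succ' j 1, Nat.choose_one_right]
      ring
    rw [e1, e2, add_right_comm, ← Finset.sum_add_distrib]
    congr 1
    · refine Finset.sum_congr rfl fun j _ => ?_
      rw [qBinom_succ_succ, Nat.add_sub_add_right]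
      ring
    · simp [qBinom_zero_right]

/-- The terms of the theta series attached to `a * b = q`. -/
def thetaTerm (q a b : R) (k : ℤ) : R :=
  if 0 ≤ k then a ^ k.toNat * q ^ (k.toNat.choose 2)
  else b ^ (-k).toNat * q ^ ((-k).toNat.choose 2)

theorem thetaTerm_natCast (q a b : R) (k : ℕ) :
    thetaTerm q a b k = a ^ k * q ^ (k.choose 2) := by
  simp [thetaTerm]

theorem thetaTerm_neg_natCast (q a b : R) (k : ℕ) :
    thetaTerm q a b (-k) = b ^ k * q ^ (k.choose 2) := by
  cases k with
  | zero => simp [thetaTerm]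
  | succ k => rw [thetaTerm, if_neg (by omega), neg_neg, Int.toNat_natCast]

theorem choose_two_add (m n : ℕ) : (m + n).choose 2 = m.choose 2 + n.choose 2 + m * n := by
  induction n with
  | zero => simp
  | succ n ih =>
    rw [← add_assoc, Nat.choose_succ_succ' (m + n) 1, Nat.choose_succ_succ' n 1, ih,
      Nat.choose_one_right, Nat.choose_one_right]
    ring

theorem two_mul_choose_two_add (n : ℕ) : 2 * n.choose 2 + n = n * n := by
  induction n with
  | zero => rfl
  | succ n ih =>
    rw [Nat.choose_succ_succ' n 1, Nat.choose_one_right]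
    linarith

/-- Recentring the summation index at n. For j < n the right side has surplus powers of a, which
combine with those of b through ab = q. -/
theorem thetaTerm_shift {q a b : R} (hab : a * b = q) {n j : ℕ} (hj : j ≤ 2 * n) :
    q ^ (j.choose 2) * a ^ j * (q ^ n) ^ (2 * n - j) =
      q ^ (n * n + n.choose 2) * a ^ n * thetaTerm q a b ((j : ℤ) - n) := by
  rcases le_total n j with h | h
  · obtain ⟨k, rfl⟩ := Nat.exists_eq_add_of_le h
    obtain ⟨l, rfl⟩ := Nat.exists_eq_add_of_le (show k ≤ n by omega)
    rw [show ((k + l + k : ℕ) : ℤ) - ((k + l : ℕ) : ℤ) = k by push_cast; ring, thetaTerm_natCast,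
      show 2 * (k + l) - (k + l + k) = l by omega, choose_two_add (k + l) k, ← pow_mul]
    ring
  · obtain ⟨l, rfl⟩ := Nat.exists_eq_add_of_le h
    rw [show ((j : ℕ) : ℤ) - ((j + l : ℕ) : ℤ) = -(l : ℤ) by push_cast; ring,
      thetaTerm_neg_natCast, show 2 * (j + l) - j = j + 2 * l by omega, choose_two_add j l,
      ← pow_mul, pow_add a, show q ^ ((j + l) * (j + l) + (j.choose 2 + l.choose 2 + j * l)) *
        (a ^ j * a ^ l) * (b ^ l * q ^ (l.choose 2)) = (a * b) ^ l *
        q ^ ((j + l) * (j + l) + j.choose 2 + j * l + 2 * l.choose 2) * a ^ j by ring, hab,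
      ← pow_add, show l + ((j + l) * (j + l) + j.choose 2 + j * l + 2 * l.choose 2) =
        (2 * l.choose 2 + l) + ((j + l) * (j + l) + j.choose 2 + j * l) by ring,
      two_mul_choose_two_add]
    ring

/-- The finite form of the Jacobi triple product identity. -/
theorem finite_triple_product {q a b : R} (hab : a * b = q) (ha : IsLeftRegular a)
    (hq : IsLeftRegular q) (n : ℕ) :
    (∏ i ∈ Finset.range n, (1 - a * q ^ i)) * ∏ i ∈ Finset.range n, (1 - b * q ^ i) =
      ∑ j ∈ Finset.range (2 * n + 1),
        (-1) ^ (j + n) * qBinom q (2 * n) j * thetaTerm q a b ((j : ℤ) - n) := by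
  have key := prod_add_mul_pow q (q ^ n) (-a) (2 * n)
  have h1 : ∏ i ∈ Finset.range (2 * n), (q ^ n + -a * q ^ i) =
      (q ^ (n * n + n.choose 2) * a ^ n) * ((-1) ^ n *
        ((∏ i ∈ Finset.range n, (1 - a * q ^ i)) * ∏ i ∈ Finset.range n, (1 - b * q ^ i))) := by
    rw [two_mul, Finset.prod_range_add]
    have e1 : ∏ i ∈ Finset.range n, (q ^ n + -a * q ^ (n + i)) =
        q ^ (n * n) * ∏ i ∈ Finset.range n, (1 - a * q ^ i) := by
      rw [show q ^ (n * n) = ∏ i ∈ Finset.range n, q ^ n by simp [pow_mul],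
        ← Finset.prod_mul_distrib]
      refine Finset.prod_congr rfl fun i _ => ?_
      ring
    -- Since ab = q, q^n - a q^i = -a q^i (1 - b q^(n-1-i)): the lower half of the factors produces
    -- the product in b, in reversed order.
    have e2 : ∏ i ∈ Finset.range n, (q ^ n + -a * q ^ i) =
        q ^ (n.choose 2) * (-a) ^ n * ∏ i ∈ Finset.range n, (1 - b * q ^ i) := by
      have e3 : q ^ (n.choose 2) = ∏ i ∈ Finset.range n, q ^ (n - 1 - i) := by
        rw [Finset.prod_range_reflect (fun i => q ^ i), Finset.prod_pow_eq_pow_sum,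
          Finset.sum_range_id, Nat.choose_two_right]
      rw [e3, ← Finset.prod_range_reflect,
        show (-a) ^ n = ∏ i ∈ Finset.range n, (-a) by simp, ← Finset.prod_mul_distrib, ← Finset.prod_mul_distrib]
      refine Finset.prod_congr rfl fun i hi => ?_
      obtain ⟨m, rfl⟩ : ∃ m, n = i + 1 + m :=
        Nat.exists_eq_add_of_le (Finset.mem_range.1 hi)
      rw [show i + 1 + m - 1 - i = m by omega]
      linear_combination (-(q ^ (m + i))) * hab
    rw [e1, e2, neg_pow a]
    ring
  have h2 : ∑ j ∈ Finset.range (2 * n + 1),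
      qBinom q (2 * n) j * q ^ (j.choose 2) * (-a) ^ j * (q ^ n) ^ (2 * n - j) =
      (q ^ (n * n + n.choose 2) * a ^ n) * ∑ j ∈ Finset.range (2 * n + 1),
        (-1) ^ j * qBinom q (2 * n) j * thetaTerm q a b ((j : ℤ) - n) := by
    rw [Finset.mul_sum]
    refine Finset.sum_congr rfl fun j hj => ?_
    have := thetaTerm_shift hab (n := n) (j := j) (by have := Finset.mem_range.1 hj; omega)
    rw [neg_pow a]
    linear_combination qBinom q (2 * n) j * (-1) ^ j * this
  rw [h1, h2] at key
  have h3 := ((hq.pow _).mul (ha.pow _)) key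
  have h4 : ((-1 : R) ^ n) * (-1) ^ n = 1 := by rw [← mul_pow]; simp
  calc _ = (-1) ^ n * ((-1) ^ n * ((∏ i ∈ Finset.range n, (1 - a * q ^ i)) *
      ∏ i ∈ Finset.range n, (1 - b * q ^ i))) := by rw [← mul_assoc, h4, one_mul]
    _ = _ := by
      rw [h3, Finset.mul_sum]
      refine Finset.sum_congr rfl fun j _ => ?_
      rw [pow_add]
      ring

theorem qFac_add_sub_dvd (q : R) (m k : ℕ) : q ^ (m + 1) ∣ qFac q (m + k) - qFac q m := by
  induction k with
  | zero => simp
  | succ k ih =>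
    rw [← add_assoc, qFac_succ, show qFac q (m + k) * (1 - q ^ (m + k + 1)) - qFac q m =
      (qFac q (m + k) - qFac q m) - q ^ (m + 1) * (q ^ k * qFac q (m + k)) by ring]
    exact dvd_sub ih (dvd_mul_right _ _)

/-- Each 1 - q^(i+1) is 1 modulo q. This lets q-factorials be cancelled from divisibilities by
powers of q. -/
theorem isCoprime_qFac (q : R) (m n : ℕ) : IsCoprime (qFac q m) (q ^ n) := by
  refine IsCoprime.pow_right (IsCoprime.prod_left fun i _ => ⟨1, q ^ i, ?_⟩)
  ring

/-- With d = n - k the smaller of m and l, the q-factorials of n, 2n and max(m, l) all agree with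
that of d modulo q^(d+1). Substituting in the quotient formula and cancelling `qFac q d` leaves 1.
-/
theorem dvd_qFac_mul_qBinom_sub_one (q : R) {n m l k : ℕ} (hm : m + k = n ∨ m = n + k)
    (hl : l + m = 2 * n) (hk : k ≤ n) :
    q ^ (n - k + 1) ∣ qFac q n * qBinom q (2 * n) m - 1 := by
  set d := n - k with hd
  have hb : ∀ r, d ≤ r → ∃ c, qFac q r = qFac q d + q ^ (d + 1) * c := fun r hr => by
    obtain ⟨t, rfl⟩ := Nat.exists_eq_add_of_le hr
    obtain ⟨c, hc⟩ := qFac_add_sub_dvd q d t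
    exact ⟨c, by rw [← hc]; ring⟩
  obtain ⟨c1, h1⟩ := hb n (by omega)
  obtain ⟨c2, h2⟩ := hb (2 * n) (by omega)
  have h3 := qBinom_mul_qFac q m l
  rw [show m + l = 2 * n by omega] at h3
  obtain ⟨c4, h4⟩ := hb (max m l) (by omega)
  have h5 : qFac q m * qFac q l = qFac q d * qFac q (max m l) := by
    rcases hm with hm | hm
    · rw [max_eq_right (by omega), show m = d by omega]
    · rw [max_eq_left (by omega), show l = d by omega, mul_comm]
  rw [h5] at h3
  refine (isCoprime_qFac q d (d + 1)).symm.dvd_of_dvd_mul_left ?_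
  rw [h4, h2] at h3
  rw [h1]
  exact ⟨c1 * qFac q d * qBinom q (2 * n) m + c2 - qBinom q (2 * n) m * qFac q d * c4, by
    linear_combination h3⟩

/-- Terms at distance k from the centre are controlled only modulo q^(n-k+1); the factor q^(k choose
2) of the theta term makes up for the loss. -/
theorem le_sub_add_choose_two {n k : ℕ} (hk : k ≤ n) : n ≤ n - k + 1 + k.choose 2 := by
  rcases k with _ | _ | k
  · omega
  · omega
  · have : k + 1 ≤ (k + 1 + 1).choose 2 := by
      rw [Nat.choose_succ_succ' (k + 1) 1, Nat.choose_one_right]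
      omega
    omega

/-- The Jacobi triple product identity modulo powers of `q`. -/
theorem triple_product_dvd {q a b : R} (hab : a * b = q) (ha : IsLeftRegular a)
    (hq : IsLeftRegular q) (n : ℕ) :
    q ^ n ∣ qFac q n * ((∏ i ∈ Finset.range n, (1 - a * q ^ i)) *
      ∏ i ∈ Finset.range n, (1 - b * q ^ i)) -
      ∑ j ∈ Finset.range (2 * n + 1), (-1) ^ (j + n) * thetaTerm q a b ((j : ℤ) - n) := by
  rw [finite_triple_product hab ha hq, Finset.mul_sum, ← Finset.sum_sub_distrib]
  refine Finset.dvd_sum fun j hj => ?_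
  have hj' : j ≤ 2 * n := by have := Finset.mem_range.1 hj; omega
  obtain ⟨k, hk, hm, c, hc⟩ : ∃ k ≤ n, (j + k = n ∨ j = n + k) ∧
      ∃ c, thetaTerm q a b ((j : ℤ) - n) = c * q ^ (k.choose 2) := by
    rcases le_total n j with h | h
    · obtain ⟨k, rfl⟩ := Nat.exists_eq_add_of_le h
      refine ⟨k, by omega, Or.inr rfl, a ^ k, ?_⟩
      rw [show ((n + k : ℕ) : ℤ) - n = k by push_cast; ring, thetaTerm_natCast]
    · obtain ⟨k, rfl⟩ := Nat.exists_eq_add_of_le h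
      refine ⟨k, by omega, Or.inl rfl, b ^ k, ?_⟩
      rw [show (j : ℤ) - ((j + k : ℕ) : ℤ) = -(k : ℤ) by push_cast; ring, thetaTerm_neg_natCast]
  obtain ⟨d, hd⟩ := dvd_qFac_mul_qBinom_sub_one q hm (l := 2 * n - j) (by omega) hk
  refine (pow_dvd_pow q (le_sub_add_choose_two hk)).trans ⟨(-1) ^ (j + n) * c * d, ?_⟩
  rw [hc, pow_add q]
  linear_combination (-1) ^ (j + n) * c * q ^ (k.choose 2) * hd

theorem dvd_prod_one_sub_X_pow_sub_one (n : ℕ) (s : Finset ℕ) (hs : ∀ i ∈ s, n ≤ i) :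
    (X : R⟦X⟧) ^ (n + 1) ∣ (∏ i ∈ s, (1 - X ^ (i + 1))) - 1 := by
  classical
  induction s using Finset.induction_on with
  | empty => simp
  | insert i s hi ih =>
    rw [Finset.prod_insert hi, show (1 - (X : R⟦X⟧) ^ (i + 1)) * (∏ i ∈ s, (1 - X ^ (i + 1))) - 1 =
      ((∏ i ∈ s, (1 - X ^ (i + 1))) - 1) - X ^ (i + 1) * ∏ i ∈ s, (1 - X ^ (i + 1)) by ring]
    refine dvd_sub (ih fun j hj => hs j (Finset.mem_insert_of_mem hj)) (Dvd.dvd.mul_right ?_ _)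
    exact pow_dvd_pow _ (by have := hs i (Finset.mem_insert_self _ _); omega)

/-- Links the infinite product to its truncations: the factors beyond the n-th change nothing below
X^(n+1). -/
theorem dvd_pentagonalSeries_sub_qFac (n : ℕ) :
    (X : R⟦X⟧) ^ (n + 1) ∣ pentagonalSeries R - qFac X n := by
  classical
  rw [X_pow_dvd_iff]
  intro m hm
  obtain ⟨s, hs⟩ := Filter.eventually_atTop.1 (coeff_prod_one_sub_X_pow_eventually_eq R m)
  have h1 := hs (s ∪ Finset.range n) Finset.subset_union_left
  rw [map_sub, ← h1, ← map_sub, ← Finset.sdiff_union_self_eq_union,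
    Finset.prod_union Finset.sdiff_disjoint]
  have h2 := dvd_prod_one_sub_X_pow_sub_one (R := R) n (s \ Finset.range n) (fun i hi => by
    simpa using (Finset.mem_sdiff.1 hi).2)
  refine X_pow_dvd_iff.1 ?_ m hm
  rw [qFac, ← sub_one_mul]
  exact h2.mul_right _

end TripleProduct

/-! ### Exponents in the cube of Euler's product -/

section Jacobi

theorem snd_eps_mul (f : DualNumber ℤ⟦X⟧) : (DualNumber.eps * f).snd = f.fst := by
  simp [TrivSqZeroExt.snd_mul]

theorem choose_two_mod_five (n : ℕ) : n.choose 2 % 5 ≠ 2 := by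
  have h := two_mul_choose_two_add n
  intro h2
  have h3 : (n * n) % 5 = (4 + n) % 5 := by omega
  rw [Nat.mul_mod] at h3
  have h4 : n % 5 < 5 := Nat.mod_lt _ (by norm_num)
  generalize hr : n % 5 = r at *
  interval_cases r <;> omega

/-- The terms are (1 + kε) X^(k+1 choose 2) for positive powers of a and (1 - kε) X^(k choose 2) for
powers of b, so their ε-parts sit at triangular exponents. -/
theorem coeff_snd_thetaTerm (m : ℕ) (k : ℤ) :
    coeff (5 * m + 2) (thetaTerm (TrivSqZeroExt.inl X : DualNumber ℤ⟦X⟧)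
      ((1 + DualNumber.eps) * TrivSqZeroExt.inl X) (1 - DualNumber.eps) k).snd = 0 := by
  have aux : ∀ (f : DualNumber ℤ⟦X⟧) (e : ℕ) (c : ℤ), f.snd = C c →
      e % 5 ≠ 2 → coeff (5 * m + 2) (f * TrivSqZeroExt.inl (X ^ e)).snd = 0 := by
    intro f e c hf he
    have : 5 * m + 2 ≠ e := by omega
    rw [TrivSqZeroExt.snd_mul, TrivSqZeroExt.snd_inl, TrivSqZeroExt.fst_inl, hf, smul_zero,
      zero_add, op_smul_eq_mul, coeff_C_mul, coeff_X_pow, if_neg this, mul_zero]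
  rcases Int.eq_nat_or_neg k with ⟨n, rfl | rfl⟩
  · rw [thetaTerm_natCast, mul_pow, mul_assoc, ← pow_add, TrivSqZeroExt.inl_pow]
    refine aux _ _ n ?_ ?_
    · simp [TrivSqZeroExt.snd_pow]
    · have := choose_two_mod_five (n + 1)
      rwa [Nat.choose_succ_succ' n 1, Nat.choose_one_right] at this
  · rw [thetaTerm_neg_natCast, TrivSqZeroExt.inl_pow]
    refine aux _ _ (-n) ?_ (choose_two_mod_five n)
    simp [TrivSqZeroExt.snd_pow]

/-- The exponents occurring in the cube of Euler's product are triangular numbers, so none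
is congruent to `2` modulo `5`. -/
theorem sect_two_pentagonalSeries_cube : sect 2 (pentagonalSeries ℤ ^ 3) = 0 := by
  ext m
  rw [coeff_sect, map_zero]
  set n := 5 * m + 2 with hn
  -- With a = (1 + ε)X and b = 1 - ε = (1 + ε)⁻¹, taking the ε-part differentiates the triple
  -- product at the zero b = 1, which is how Jacobi's cube identity arises.
  set q : DualNumber ℤ⟦X⟧ := TrivSqZeroExt.inl X with hq
  set a : DualNumber ℤ⟦X⟧ := (1 + DualNumber.eps) * q with ha
  set b : DualNumber ℤ⟦X⟧ := 1 - DualNumber.eps with hb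
  have hX : ∀ f : ℤ⟦X⟧, X * f = 0 → f = 0 := fun f hf => by
    simpa [X_ne_zero] using hf
  have hqr : IsLeftRegular q := by
    rw [isLeftRegular_iff_right_eq_zero_of_mul]
    intro f hf
    have h1 := congrArg TrivSqZeroExt.fst hf
    have h2 := congrArg TrivSqZeroExt.snd hf
    rw [TrivSqZeroExt.fst_mul] at h1
    rw [TrivSqZeroExt.snd_mul] at h2
    simp only [hq, TrivSqZeroExt.fst_inl, TrivSqZeroExt.snd_inl, TrivSqZeroExt.fst_zero,
      TrivSqZeroExt.snd_zero, smul_zero, add_zero, smul_eq_mul] at h1 h2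
    exact TrivSqZeroExt.ext (hX _ h1) (hX _ h2)
  have hu : b * (1 + DualNumber.eps) = 1 := by
    rw [hb]
    linear_combination -(DualNumber.eps_mul_eps (R := ℤ⟦X⟧))
  have hab : a * b = q := by
    rw [ha]
    linear_combination q * hu
  have har : IsLeftRegular a := by
    refine IsLeftRegular.mul ?_ hqr
    intro f g hfg
    have := congrArg (fun t => b * t) hfg
    simpa [← mul_assoc, hu] using this
  obtain ⟨w, hw⟩ := triple_product_dvd hab har hqr (n + 1)
  have hw2 := congrArg TrivSqZeroExt.snd hw
  have hq' : q ^ (n + 1) = TrivSqZeroExt.inl (X ^ (n + 1)) := by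
    rw [hq, TrivSqZeroExt.inl_pow]
  have hfac : ∀ k, qFac q k = TrivSqZeroExt.inl (qFac X k) := fun k => by
    exact (qFac_map (TrivSqZeroExt.inlHom ℤ⟦X⟧ ℤ⟦X⟧) X k).symm
  have hfst : ∀ (f : DualNumber ℤ⟦X⟧), f.fst = TrivSqZeroExt.fstHom ℤ⟦X⟧ ℤ⟦X⟧ ℤ⟦X⟧ f := fun _ => rfl
  -- The factor i = 0 of the b-product is 1 - b = ε, so the ε-part is the remaining product at ε =
  -- 0. Losing that factor explains the single `qFac X n`.
  have hprod : (qFac q (n + 1) * ((∏ i ∈ Finset.range (n + 1), (1 - a * q ^ i)) *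
      ∏ i ∈ Finset.range (n + 1), (1 - b * q ^ i))).snd =
      qFac X (n + 1) * qFac X (n + 1) * qFac X n := by
    rw [Finset.prod_range_succ' (fun i => 1 - b * q ^ i), pow_zero, mul_one,
      show 1 - b = DualNumber.eps by rw [hb]; ring,
      show ∀ u v w e : DualNumber ℤ⟦X⟧, u * (v * (w * e)) = e * (u * v * w) by intros; ring,
      snd_eps_mul, hfst, map_mul, map_mul, map_prod, map_prod, hfac]
    simp only [← hfst, ha, hb, hq]
    simp [qFac, pow_succ, mul_comm]
  rw [TrivSqZeroExt.snd_sub, hprod, hq', TrivSqZeroExt.snd_mul, TrivSqZeroExt.snd_inl,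
    TrivSqZeroExt.fst_inl, smul_zero, add_zero, smul_eq_mul, sub_eq_iff_eq_add,
    TrivSqZeroExt.snd_sum] at hw2
  have h1 := (pow_dvd_pow X (by omega : n + 1 ≤ n + 1 + 1)).trans
    (dvd_pentagonalSeries_sub_qFac (R := ℤ) (n + 1))
  have h2 := dvd_pentagonalSeries_sub_qFac (R := ℤ) n
  have h3 : (X : ℤ⟦X⟧) ^ (n + 1) ∣ pentagonalSeries ℤ ^ 3 -
      qFac X (n + 1) * qFac X (n + 1) * qFac X n := by
    rw [show pentagonalSeries ℤ ^ 3 - qFac X (n + 1) * qFac X (n + 1) * qFac X n =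
      (pentagonalSeries ℤ - qFac X (n + 1)) * (pentagonalSeries ℤ ^ 2 +
        qFac X (n + 1) * pentagonalSeries ℤ) +
      (pentagonalSeries ℤ - qFac X n) * (qFac X (n + 1) * qFac X (n + 1)) by ring]
    exact dvd_add (h1.mul_right _) (h2.mul_right _)
  have h4 := X_pow_dvd_iff.1 h3 n n.lt_succ_self
  rw [map_sub, sub_eq_zero] at h4
  rw [h4, hw2, map_add, map_sum, X_pow_dvd_iff.1 (dvd_mul_right _ _) n n.lt_succ_self, zero_add]
  refine Finset.sum_eq_zero fun j _ => ?_
  have h5 := coeff_snd_thetaTerm m ((j : ℤ) - (n + 1 : ℕ))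
  rcases neg_one_pow_eq_or (DualNumber ℤ⟦X⟧) (j + (n + 1)) with h | h
  · rw [h, one_mul]
    exact h5
  · rw [h, neg_one_mul, TrivSqZeroExt.snd_neg, map_neg, neg_eq_zero]
    exact h5

end Jacobi

/-! ### The series of 3-cores and its self-similarity -/

section ThreeCores
open LaurentPolynomial

/-- Lattice points on the ellipse describing the `3`-cores of size `m`. -/
def coreSet (m : ℕ) : Set (ℤ × ℤ) :=
  {p | 3 * (p.1 ^ 2 + p.1 * p.2 + p.2 ^ 2) + 2 * p.1 + p.2 = m}

/-- Modulo 5 the equation reads u² + uj + j² = 0 with u = i + 2, and this form is anisotropic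
because -3 is not a square. -/
theorem mod_five_of_core : ∀ i j : ZMod 5, 3 * (i ^ 2 + i * j + j ^ 2) + 2 * i + j = 3 →
    i + 2 = 0 ∧ j = 0 := by decide

/-- The ellipses have common centre (-1/3, 0). The homothety of ratio -5 about it is (i, j) ↦ (-5i -
2, -5j); the sign makes it integral. It sends level l to level 25l + 8 = 5(5l + 1) + 3. -/
theorem coreSet_dilate {t : ℕ} {p : ℤ × ℤ} (hp : p ∈ coreSet (5 * t + 3)) :
    ∃ l, t = 5 * l + 1 ∧ ∃ r ∈ coreSet l, p = (-5 * r.1 - 2, -5 * r.2) := by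
  obtain ⟨i, j⟩ := p
  have h : 3 * (i ^ 2 + i * j + j ^ 2) + 2 * i + j = ((5 * t + 3 : ℕ) : ℤ) := hp
  have h5 := congrArg (fun z : ℤ => (z : ZMod 5)) h
  have h50 : (5 : ZMod 5) = 0 := by decide
  push_cast at h5
  rw [h50, zero_mul, zero_add] at h5
  obtain ⟨hi, hj⟩ := mod_five_of_core _ _ h5
  obtain ⟨c, hc⟩ := (ZMod.intCast_zmod_eq_zero_iff_dvd (i + 2) 5).1 (by push_cast; exact hi)
  obtain ⟨d, rfl⟩ := (ZMod.intCast_zmod_eq_zero_iff_dvd j 5).1 hj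
  obtain rfl : i = 5 * c - 2 := by push_cast at hc; linarith
  push_cast at h
  have ht : (t : ℤ) = 5 * (3 * ((-c) ^ 2 + (-c) * (-d) + (-d) ^ 2) + 2 * (-c) + (-d)) + 1 := by
    linarith
  have h0 : 0 ≤ 3 * ((-c) ^ 2 + (-c) * (-d) + (-d) ^ 2) + 2 * (-c) + (-d) := by omega
  obtain ⟨l, hl⟩ := Int.eq_ofNat_of_zero_le h0
  refine ⟨l, by omega, (-c, -d), hl, ?_⟩
  simp

theorem ncard_coreSet_of_dilate (l : ℕ) :
    (coreSet (5 * (5 * l + 1) + 3)).ncard = (coreSet l).ncard := by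
  symm
  refine Set.ncard_congr (fun r _ => (-5 * r.1 - 2, -5 * r.2)) ?_ ?_ ?_
  · rintro ⟨i, j⟩ h
    have h' : 3 * (i ^ 2 + i * j + j ^ 2) + 2 * i + j = (l : ℤ) := h
    change 3 * ((-5 * i - 2) ^ 2 + (-5 * i - 2) * (-5 * j) + (-5 * j) ^ 2) + 2 * (-5 * i - 2) +
      (-5 * j) = ((5 * (5 * l + 1) + 3 : ℕ) : ℤ)
    push_cast
    linear_combination 25 * h'
  · rintro ⟨i, j⟩ ⟨i', j'⟩ _ _ h
    simp only [Prod.mk.injEq] at h ⊢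
    omega
  · rintro p hp
    obtain ⟨l', h1, r, h2, h3⟩ := coreSet_dilate hp
    obtain rfl : l = l' := by omega
    exact ⟨r, h2, h3.symm⟩

theorem coreSet_eq_empty {t : ℕ} (h : t % 5 ≠ 1) : coreSet (5 * t + 3) = ∅ := by
  ext p
  refine iff_of_false (fun hp => ?_) (Set.notMem_empty _)
  obtain ⟨l, h1, -⟩ := coreSet_dilate hp
  omega

/-- The generating function of the `3`-cores. -/
noncomputable def coreSeries : ℤ⟦X⟧ := mk fun m => ((coreSet m).ncard : ℤ)

theorem sect_three_coreSeries : sect 3 coreSeries = X * expand5 coreSeries := by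
  ext t
  rw [coeff_sect, coreSeries, coeff_mk]
  by_cases h : t % 5 = 1
  · obtain ⟨l, rfl⟩ : ∃ l, t = 5 * l + 1 := ⟨t / 5, by omega⟩
    rw [ncard_coreSet_of_dilate, coeff_succ_X_mul, coeff_expand_mul, coeff_mk]
  · rw [coreSet_eq_empty h]
    cases t with
    | zero => simp
    | succ t =>
      rw [coeff_succ_X_mul, coeff_expand_of_not_dvd _ _ _ (by omega)]
      simp

/-- The exponent of the `k`-th term of the theta series attached to `X ^ (3 - s)` and `X ^ s`. -/
def coreExp (s : ℕ) (k : ℤ) : ℕ :=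
  if 0 ≤ k then (3 - s) * k.toNat + 3 * k.toNat.choose 2
  else s * (-k).toNat + 3 * (-k).toNat.choose 2

theorem two_mul_coreExp {s : ℕ} (hs : s ≤ 3) (k : ℤ) :
    2 * (coreExp s k : ℤ) = 3 * k * (k + 1) - 2 * s * k := by
  rcases Int.eq_nat_or_neg k with ⟨n, rfl | rfl⟩
  · have h := congrArg (fun z : ℕ => (z : ℤ)) (two_mul_choose_two_add n)
    push_cast at h
    simp only [coreExp, Int.natCast_nonneg, if_true, Int.toNat_natCast]
    push_cast [Nat.cast_sub hs]
    linear_combination 3 * h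
  · have h := congrArg (fun z : ℕ => (z : ℤ)) (two_mul_choose_two_add n)
    push_cast at h
    rcases n with _ | n
    · simp [coreExp]
    · rw [coreExp, if_neg (by omega), neg_neg, Int.toNat_natCast]
      push_cast at h ⊢
      linear_combination 3 * h

/-- Guarantees that a theta sum truncated at |k| ≤ n already contains every term of exponent less
than n. -/
theorem natAbs_le_coreExp {s : ℕ} (hs : s ≤ 2) (k : ℤ) : k.natAbs ≤ coreExp s k + 1 := by
  have h := two_mul_coreExp (hs.trans (by norm_num)) k
  have hs' : (s : ℤ) ≤ 2 := by exact_mod_cast hs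
  have hs0 : (0 : ℤ) ≤ s := Int.natCast_nonneg s
  rcases Int.eq_nat_or_neg k with ⟨n, rfl | rfl⟩ 
  · simp only [Int.natAbs_natCast]
    zify
    nlinarith
  · simp only [Int.natAbs_neg, Int.natAbs_natCast]
    zify
    nlinarith

theorem thetaTerm_laurent (s : ℕ) (k : ℤ) :
    thetaTerm (LaurentPolynomial.C (X ^ 3) : LaurentPolynomial ℤ⟦X⟧)
      (T 1 * LaurentPolynomial.C (X ^ (3 - s))) (T (-1) * LaurentPolynomial.C (X ^ s)) k =
      T k * LaurentPolynomial.C (X ^ coreExp s k) := by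
  rcases Int.eq_nat_or_neg k with ⟨n, rfl | rfl⟩
  · rw [thetaTerm_natCast, mul_pow, T_pow, ← map_pow, ← map_pow, mul_assoc, ← map_mul, ← pow_mul,
      ← pow_mul, ← pow_add, mul_one]
    simp [coreExp]
  · rcases n with _ | n
    · simp [thetaTerm, coreExp]
    · rw [thetaTerm_neg_natCast, mul_pow, T_pow, ← map_pow, ← map_pow, mul_assoc, ← map_mul,
        ← pow_mul, ← pow_mul, ← pow_add, mul_neg_one, coreExp, if_neg (by omega), neg_neg,
        Int.toNat_natCast]

/-- The constant term of a Laurent polynomial. -/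
noncomputable def constTerm : LaurentPolynomial ℤ⟦X⟧ →ₗ[ℤ⟦X⟧] ℤ⟦X⟧ where
  toFun f := f.coeff 0
  map_add' f g := by simp
  map_smul' c f := by simp

theorem constTerm_C_mul (f : ℤ⟦X⟧) (g : LaurentPolynomial ℤ⟦X⟧) :
    constTerm (LaurentPolynomial.C f * g) = f * constTerm g := by
  rw [← LaurentPolynomial.smul_eq_C_mul, map_smul, smul_eq_mul]

theorem constTerm_T_mul_C (k : ℤ) (f : ℤ⟦X⟧) :
    constTerm (T k * LaurentPolynomial.C f) = if k = 0 then f else 0 := by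
  rw [mul_comm, ← single_eq_C_mul_T]
  change (AddMonoidAlgebra.single k f).coeff 0 = _
  rw [AddMonoidAlgebra.coeff_single]
  exact Finsupp.single_apply

theorem constTerm_sum_thetaTerm (n : ℕ) :
    constTerm (∑ j ∈ Finset.range (2 * n + 1), (-1) ^ (j + n) *
      thetaTerm (LaurentPolynomial.C X : LaurentPolynomial ℤ⟦X⟧)
        (T 1 * LaurentPolynomial.C X) (T (-1)) ((j : ℤ) - n)) = 1 := by
  have h : ∀ k : ℤ, ∃ f, thetaTerm (LaurentPolynomial.C X : LaurentPolynomial ℤ⟦X⟧)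
      (T 1 * LaurentPolynomial.C X) (T (-1)) k = T k * LaurentPolynomial.C f := by
    intro k
    rcases Int.eq_nat_or_neg k with ⟨n, rfl | rfl⟩
    · exact ⟨X ^ n * X ^ (n.choose 2), by
        rw [thetaTerm_natCast, mul_pow, T_pow, map_mul, map_pow, map_pow, mul_one, mul_assoc]⟩
    · exact ⟨X ^ (n.choose 2), by rw [thetaTerm_neg_natCast, T_pow, map_pow, mul_neg_one]⟩
  have hs : ∀ i : ℕ, ((-1) ^ i : LaurentPolynomial ℤ⟦X⟧) = LaurentPolynomial.C ((-1) ^ i) := by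
    simp
  rw [map_sum, Finset.sum_eq_single n]
  · obtain ⟨f, hf⟩ := h ((n : ℤ) - n)
    have h1 := constTerm_T_mul_C 0 1
    rw [T_zero, map_one, one_mul, if_pos rfl] at h1
    rw [sub_self, ← two_mul, pow_mul, show (-1 : LaurentPolynomial ℤ⟦X⟧) ^ 2 = 1 by ring, one_pow,
      one_mul]
    simpa [thetaTerm] using h1
  · intro j _ hj
    obtain ⟨f, hf⟩ := h ((j : ℤ) - n)
    rw [hf, hs, constTerm_C_mul, constTerm_T_mul_C, if_neg (by omega), mul_zero]
  · intro h
    exact absurd (Finset.mem_range.2 (by omega)) h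

/-- A truncation of the theta series attached to `X ^ (3 - s)` and `X ^ s`. -/
noncomputable def thetaSum (s n : ℕ) : LaurentPolynomial ℤ⟦X⟧ :=
  ∑ j ∈ Finset.range (2 * n + 1), (-1) ^ (j + n) *
    thetaTerm (LaurentPolynomial.C (X ^ 3))
      (T 1 * LaurentPolynomial.C (X ^ (3 - s))) (T (-1) * LaurentPolynomial.C (X ^ s)) ((j : ℤ) - n)

/-- The power of T is the sum of the three centred indices, so the constant term keeps the triples
of sum zero. Their sign exponent is 6n, hence no signs survive. -/
theorem constTerm_thetaSum_mul (n : ℕ) :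
    constTerm (thetaSum 0 n * (thetaSum 1 n * thetaSum 2 n)) =
      ∑ j ∈ Finset.range (2 * n + 1) ×ˢ (Finset.range (2 * n + 1) ×ˢ Finset.range (2 * n + 1)),
        if j.1 + (j.2.1 + j.2.2) = 3 * n then
          X ^ (coreExp 0 ((j.1 : ℤ) - n) + (coreExp 1 ((j.2.1 : ℤ) - n) +
            coreExp 2 ((j.2.2 : ℤ) - n)))
        else 0 := by
  have hs : ∀ i : ℕ, ((-1) ^ i : LaurentPolynomial ℤ⟦X⟧) = LaurentPolynomial.C ((-1) ^ i) := by
    simp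
  simp only [thetaSum, thetaTerm_laurent]
  rw [Finset.sum_mul_sum, ← Finset.sum_product', Finset.sum_mul_sum, ← Finset.sum_product', map_sum]
  refine Finset.sum_congr rfl fun j _ => ?_
  obtain ⟨a, b, c⟩ := j
  dsimp only
  rw [show ∀ u1 u2 u3 t1 t2 t3 v1 v2 v3 : LaurentPolynomial ℤ⟦X⟧,
    u1 * (t1 * v1) * (u2 * (t2 * v2) * (u3 * (t3 * v3))) =
      u1 * u2 * u3 * (t1 * (t2 * t3) * (v1 * (v2 * v3))) by intros; ring, ← T_add, ← T_add,
    ← map_mul, ← map_mul, ← pow_add, ← pow_add, ← pow_add, ← pow_add, hs, constTerm_C_mul,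
    constTerm_T_mul_C]
  by_cases h : a + (b + c) = 3 * n
  · rw [if_pos (by omega), if_pos h, show a + n + (b + n) + (c + n) = 2 * (3 * n) by omega, pow_mul]
    simp
  · rw [if_neg (by omega), if_neg h, mul_zero]

/-- Eliminating the third index by c = -a - b turns the total exponent into the quadratic polynomial
of `coreSet`. -/
theorem coeff_constTerm_thetaSum_mul {m n : ℕ} (h : m < n) :
    coeff m (constTerm (thetaSum 0 n * (thetaSum 1 n * thetaSum 2 n))) = coeff m coreSeries := by
  rw [constTerm_thetaSum_mul, map_sum, coreSeries, coeff_mk]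
  set A := Finset.range (2 * n + 1) ×ˢ (Finset.range (2 * n + 1) ×ˢ Finset.range (2 * n + 1))
  set e : ℕ × ℕ × ℕ → ℕ := fun j => coreExp 0 ((j.1 : ℤ) - n) + (coreExp 1 ((j.2.1 : ℤ) - n) +
            coreExp 2 ((j.2.2 : ℤ) - n)) with he
  have h1 : ∀ j ∈ A, coeff m (if j.1 + (j.2.1 + j.2.2) = 3 * n then (X : ℤ⟦X⟧) ^ e j else 0) =
      if j.1 + (j.2.1 + j.2.2) = 3 * n ∧ m = e j then 1 else 0 := by
    intro j _
    by_cases hj : j.1 + (j.2.1 + j.2.2) = 3 * n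
    · simp [hj, coeff_X_pow]
    · simp [hj]
  rw [Finset.sum_congr rfl h1, Finset.sum_boole, ← Set.ncard_coe_finset]
  congr 1
  have hcore : ∀ a b c : ℤ, a + b + c = 0 →
      ((coreExp 0 a + (coreExp 1 b + coreExp 2 c) : ℕ) : ℤ) =
        3 * (a ^ 2 + a * b + b ^ 2) + 2 * a + b := by
    intro a b c habc
    have h0 := two_mul_coreExp (s := 0) (by norm_num) a
    have h1 := two_mul_coreExp (s := 1) (by norm_num) b
    have h2 := two_mul_coreExp (s := 2) (by norm_num) c
    obtain rfl : c = -a - b := by linarith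
    push_cast at h0 h1 h2 ⊢
    linarith
  refine Set.ncard_congr (fun j _ => ((j.1 : ℤ) - n, (j.2.1 : ℤ) - n)) ?_ ?_ ?_
  · intro j hj
    simp only [Finset.mem_coe, Finset.mem_filter] at hj
    obtain ⟨-, hj1, hj2⟩ := hj
    change 3 * (_ ^ 2 + _ + _ ^ 2) + _ + _ = _
    rw [← hcore _ _ ((j.2.2 : ℤ) - n) (by dsimp only; omega), hj2]
  · rintro ⟨a, b, c⟩ ⟨a', b', c'⟩ hj hj' hjj
    simp only [Finset.mem_coe, Finset.mem_filter] at hj hj'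
    simp only [Prod.mk.injEq] at hjj ⊢
    omega
  · rintro ⟨a, b⟩ hab
    have hab' : 3 * (a ^ 2 + a * b + b ^ 2) + 2 * a + b = (m : ℤ) := hab
    rw [← hcore a b (-a - b) (by ring)] at hab'
    have hm : coreExp 0 a + (coreExp 1 b + coreExp 2 (-a - b)) = m := by exact_mod_cast hab'
    have ha := natAbs_le_coreExp (s := 0) (by norm_num) a
    have hb := natAbs_le_coreExp (s := 1) (by norm_num) b
    have hc := natAbs_le_coreExp (s := 2) (by norm_num) (-a - b)
    have ha' : -(n : ℤ) ≤ a ∧ a ≤ n := by omega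
    have hb' : -(n : ℤ) ≤ b ∧ b ≤ n := by omega
    have hc' : -(n : ℤ) ≤ -a - b ∧ -a - b ≤ n := by omega
    clear hcore hab hab' ha hb hc
    refine ⟨((a + n).toNat, (b + n).toNat, (-a - b + n).toNat), ?_, ?_⟩
    · have e1 : (((a + n).toNat : ℕ) : ℤ) - n = a := by omega
      have e2 : (((b + n).toNat : ℕ) : ℤ) - n = b := by omega
      have e3 : (((-a - b + n).toNat : ℕ) : ℤ) - n = -a - b := by omega
      simp only [A, Finset.mem_coe, Finset.mem_filter, Finset.mem_product, Finset.mem_range, he,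
        e1, e2, e3, hm, and_true]
      clear hm
      omega
    · simp only [Prod.mk.injEq]
      omega

/-- The cubes of the two Euler products differ by the generating function of the `3`-cores. -/
theorem expand3_pentagonalSeries_cube :
    expand3 (pentagonalSeries ℤ) ^ 3 = pentagonalSeries ℤ * coreSeries := by
  ext m
  set n := m + 1 with hn
  set L := LaurentPolynomial ℤ⟦X⟧
  set c : ℤ⟦X⟧ →+* L := LaurentPolynomial.C with hc
  have hT : IsUnit (T 1 : L) := isUnit_T 1
  have hTT : (T 1 : L) * T (-1) = 1 := by rw [← T_add]; simp
  have hreg : ∀ k, IsLeftRegular (c (X ^ k)) := by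
    intro k f g hfg
    dsimp only at hfg
    rw [hc, ← LaurentPolynomial.smul_eq_C_mul, ← LaurentPolynomial.smul_eq_C_mul] at hfg
    refine LaurentPolynomial.ext fun i => ?_
    have := congrArg (fun t => t.coeff i) hfg
    simpa [X_ne_zero] using this
  have hregT : ∀ k, IsLeftRegular (T 1 * c (X ^ k)) := fun k => hT.isRegular.left.mul (hreg k)
  -- The triple product with base X and 3n factors is compared with three triple products of base
  -- X^3 and n factors: sorting the factors by exponent modulo 3 shows that both involve the same
  -- product.
  have k1 := triple_product_dvd (q := c X) (a := T 1 * c X) (b := T (-1))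
    (by linear_combination c X * hTT) (by have := hregT 1; rwa [pow_one] at this) (by have := hreg 1; rwa [pow_one] at this) (3 * n)
  have k2 : ∀ s ≤ 3, (c (X ^ 3)) ^ n ∣ qFac (c (X ^ 3)) n *
      ((∏ i ∈ Finset.range n, (1 - T 1 * c (X ^ (3 - s)) * c (X ^ 3) ^ i)) *
        ∏ i ∈ Finset.range n, (1 - T (-1) * c (X ^ s) * c (X ^ 3) ^ i)) - thetaSum s n := by
    intro s hs
    refine triple_product_dvd ?_ (hregT _) (hreg 3) n
    calc T 1 * c (X ^ (3 - s)) * (T (-1) * c (X ^ s)) =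
        T 1 * T (-1) * (c (X ^ (3 - s)) * c (X ^ s)) := by ring
      _ = c (X ^ 3) := by rw [hTT, one_mul, ← map_mul, ← pow_add, Nat.sub_add_cancel hs]
  have hsplit : ∀ f : ℕ → L, ∏ i ∈ Finset.range (3 * n), f i =
      (∏ i ∈ Finset.range n, f (3 * i)) * (∏ i ∈ Finset.range n, f (3 * i + 1)) *
        ∏ i ∈ Finset.range n, f (3 * i + 2) := by
    intro f
    generalize n = n
    induction n with
    | zero => simp
    | succ n ih =>
      rw [show 3 * (n + 1) = 3 * n + 1 + 1 + 1 by ring, Finset.prod_range_succ,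
        Finset.prod_range_succ, Finset.prod_range_succ, ih, Finset.prod_range_succ,
        Finset.prod_range_succ, Finset.prod_range_succ]
      ring
  rw [hsplit, hsplit] at k1
  obtain ⟨w, hw⟩ := k1
  obtain ⟨w0, hw0⟩ := k2 0 (by norm_num)
  obtain ⟨w1, hw1⟩ := k2 1 (by norm_num)
  obtain ⟨w2, hw2⟩ := k2 2 (by norm_num)
  have hpow : ∀ r i : ℕ, c (X ^ r) * c (X ^ 3) ^ i = c (X ^ (3 * i + r)) := fun r i => by
    rw [← map_pow, ← map_mul]
    congr 1
    ring
  have hpow1 : ∀ i : ℕ, c X * c X ^ i = c (X ^ (i + 1)) := fun i => by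
    rw [map_pow]
    ring
  simp only [mul_assoc (T 1), mul_assoc (T (-1)), hpow, hpow1, Nat.sub_zero, pow_zero,
    map_one, mul_one, ← qFac_map] at hw hw0 hw1 hw2
  have hpow2 : ∀ i : ℕ, (c X ^ 3) ^ i = c X ^ (3 * i) := fun i => (pow_mul _ _ _).symm
  simp only [hpow2, map_pow, Nat.reduceSub, add_assoc, Nat.reduceAdd] at hw hw0 hw1 hw2
  set p1 := ∏ x ∈ Finset.range n, (1 - T 1 * c X ^ (3 * x + 1))
  set p2 := ∏ x ∈ Finset.range n, (1 - T 1 * c X ^ (3 * x + 2))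
  set p3 := ∏ x ∈ Finset.range n, (1 - T 1 * c X ^ (3 * x + 3))
  set m0 := ∏ x ∈ Finset.range n, (1 - T (-1) * c X ^ (3 * x))
  set m1 := ∏ x ∈ Finset.range n, (1 - T (-1) * c X ^ (3 * x + 1))
  set m2 := ∏ x ∈ Finset.range n, (1 - T (-1) * c X ^ (3 * x + 2))
  set d1 := qFac (X : ℤ⟦X⟧) (3 * n)
  set d3 := qFac (X ^ 3 : ℤ⟦X⟧) n
  have hS := constTerm_sum_thetaTerm (3 * n)
  rw [← hc] at hS
  set S := ∑ j ∈ Finset.range (2 * (3 * n) + 1), (-1) ^ (j + 3 * n) *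
    thetaTerm (c X) (T 1 * c X) (T (-1)) ((j : ℤ) - (3 * n : ℕ))
  have hV := coeff_constTerm_thetaSum_mul (m := m) (n := n)
  set Θ0 := thetaSum 0 n
  set Θ1 := thetaSum 1 n
  set Θ2 := thetaSum 2 n
  have hmain : c (d3 ^ 3) * S - c d1 * (Θ0 * (Θ1 * Θ2)) = c (X ^ (3 * n)) * (-(c d3) ^ 3 * w +
      c d1 * (w0 * Θ1 * Θ2 + c d3 * (p3 * m0) * w1 * Θ2 +
        c d3 * (p3 * m0) * (c d3 * (p2 * m1)) * w2)) := by
    rw [map_pow, map_pow]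
    linear_combination -(c d3) ^ 3 * hw + c d1 * (Θ1 * Θ2 * hw0 + c d3 * (p3 * m0) * Θ2 * hw1 +
      c d3 * (p3 * m0) * (c d3 * (p2 * m1)) * hw2)
  -- Taking constant terms in T: `S` contributes 1 and the product of the three theta sums
  -- contributes the 3-core series.
  have hct := congrArg constTerm hmain
  rw [map_sub, constTerm_C_mul, constTerm_C_mul, constTerm_C_mul, hS, mul_one] at hct
  set V := constTerm (Θ0 * (Θ1 * Θ2))
  have hE3 : (X : ℤ⟦X⟧) ^ (m + 1) ∣ expand3 (pentagonalSeries ℤ) - d3 := by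
    have h := map_dvd expand3 (dvd_pentagonalSeries_sub_qFac (R := ℤ) n)
    rw [map_pow, map_sub, expand_X, ← pow_mul] at h
    rw [show d3 = expand3 (qFac X n) by
      rw [show expand3 (qFac (X : ℤ⟦X⟧) n) = (expand3 : ℤ⟦X⟧ →ₐ[ℤ] ℤ⟦X⟧).toRingHom (qFac X n)
        from rfl, qFac_map]
      simp [d3]]
    exact (pow_dvd_pow X (by omega)).trans h
  have hE1 : (X : ℤ⟦X⟧) ^ (m + 1) ∣ pentagonalSeries ℤ - d1 :=
    (pow_dvd_pow X (by omega)).trans (dvd_pentagonalSeries_sub_qFac (R := ℤ) (3 * n))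
  have hVc : (X : ℤ⟦X⟧) ^ (m + 1) ∣ V - coreSeries := by
    rw [X_pow_dvd_iff]
    intro i hi
    rw [map_sub, coeff_constTerm_thetaSum_mul (by omega : i < n), sub_self]
  have hX : (X : ℤ⟦X⟧) ^ (m + 1) ∣ d3 ^ 3 - d1 * V := by
    rw [hct]
    exact (pow_dvd_pow X (by omega)).mul_right _
  have hfin : (X : ℤ⟦X⟧) ^ (m + 1) ∣ expand3 (pentagonalSeries ℤ) ^ 3 -
      pentagonalSeries ℤ * coreSeries := by
    rw [show expand3 (pentagonalSeries ℤ) ^ 3 - pentagonalSeries ℤ * coreSeries =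
      (expand3 (pentagonalSeries ℤ) - d3) * (expand3 (pentagonalSeries ℤ) ^ 2 +
        expand3 (pentagonalSeries ℤ) * d3 + d3 ^ 2) + (d3 ^ 3 - d1 * V) -
        (pentagonalSeries ℤ - d1) * V + pentagonalSeries ℤ * (V - coreSeries) by ring]
    exact dvd_add (dvd_sub (dvd_add (hE3.mul_right _) hX) (hE1.mul_right _)) (hVc.mul_left _)
  have := X_pow_dvd_iff.1 hfin m m.lt_succ_self
  rwa [map_sub, sub_eq_zero] at this

end ThreeCores

/-! ### The 5-dissection of Euler's product -/

section Euler

theorem map_pentagonalSeries {R S : Type*} [CommRing R] [CommRing S] (h : R →+* S) :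
    map h (pentagonalSeries R) = pentagonalSeries S := by
  ext n
  rw [coeff_map]
  by_cases hn : n ∈ Set.range pentagonal
  · obtain ⟨k, rfl⟩ := hn
    simp
  · rw [coeff_pentagonalSeries_eq_zero _ hn, coeff_pentagonalSeries_eq_zero _ hn, map_zero]

/-- Residues 3 and 4 never occur, and residue 1 occurs only for k = 5l + 1, where the pentagonal
numbers reproduce themselves scaled by 25. This gives sections 1, 3 and 4 of E. -/
theorem pentagonal_mod_five (k : ℤ) : (pentagonal k % 5 = 0 ∨ pentagonal k % 5 = 2) ∨
    ∃ l, k = 5 * l + 1 ∧ pentagonal k = 5 * (5 * pentagonal (-l)) + 1 := by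
  obtain ⟨l, r, hr, rfl⟩ : ∃ l r : ℤ, (r = 0 ∨ r = 1 ∨ r = 2 ∨ r = 3 ∨ r = 4) ∧ k = 5 * l + r :=
    ⟨k / 5, k % 5, by omega, by omega⟩
  have h := two_mul_natCast_pentagonal (5 * l + r)
  generalize hl : pentagonal (5 * l + r) = p at *
  have h' := two_mul_natCast_pentagonal_neg l
  rcases hr with rfl | rfl | rfl | rfl | rfl
  · left; left
    ring_nf at h
    omega
  · right
    refine ⟨l, rfl, ?_⟩
    have : (p : ℤ) = 5 * (5 * pentagonal (-l)) + 1 := by linarith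
    exact_mod_cast this
  · left; left
    ring_nf at h
    omega
  · left; right
    ring_nf at h
    omega
  · left; right
    ring_nf at h
    omega

theorem coeff_pentagonalSeries_eq_zero_of_forall {n : ℕ} (h : ∀ k, pentagonal k ≠ n) :
    coeff n (pentagonalSeries ℤ) = 0 :=
  coeff_pentagonalSeries_eq_zero ℤ (by rintro ⟨k, hk⟩; exact h k hk)

theorem sect_three_pentagonalSeries : sect 3 (pentagonalSeries ℤ) = 0 := by
  ext n
  rw [coeff_sect, coeff_pentagonalSeries_eq_zero_of_forall, map_zero]
  intro k hk
  rcases pentagonal_mod_five k with h | ⟨l, -, h⟩ <;> omega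

theorem sect_four_pentagonalSeries : sect 4 (pentagonalSeries ℤ) = 0 := by
  ext n
  rw [coeff_sect, coeff_pentagonalSeries_eq_zero_of_forall, map_zero]
  intro k hk
  rcases pentagonal_mod_five k with h | ⟨l, -, h⟩ <;> omega

theorem sect_one_pentagonalSeries :
    sect 1 (pentagonalSeries ℤ) = -expand5 (pentagonalSeries ℤ) := by
  ext n
  rw [coeff_sect, map_neg]
  by_cases hn : ∃ l, 5 * pentagonal l = n
  · obtain ⟨l, rfl⟩ := hn
    rw [coeff_expand_mul, coeff_pentagonalSeries_pentagonal]
    have h1 := two_mul_natCast_pentagonal (5 * (-l) + 1)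
    have h2 := two_mul_natCast_pentagonal l
    have h3 : pentagonal (5 * (-l) + 1) = 5 * (5 * pentagonal l) + 1 := by
      have : (pentagonal (5 * (-l) + 1) : ℤ) = 5 * (5 * pentagonal l) + 1 := by linarith
      exact_mod_cast this
    rw [← h3, coeff_pentagonalSeries_pentagonal, Int.negOnePow_succ, mul_neg, Int.negOnePow_neg]
    rcases Int.even_or_odd l with hl | hl
    · rw [Int.negOnePow_even _ hl, Int.negOnePow_even _ (hl.mul_left 5)]
      simp
    · rw [Int.negOnePow_odd _ hl, Int.negOnePow_odd _ (by
        exact Odd.mul (by decide) hl)]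
      simp
  · have h0 : coeff n (expand5 (pentagonalSeries ℤ)) = 0 := by
      rw [coeff_expand]
      split_ifs with hd
      · refine coeff_pentagonalSeries_eq_zero_of_forall fun k hk => hn ⟨k, ?_⟩
        omega
      · rfl
    rw [h0, neg_zero, coeff_pentagonalSeries_eq_zero_of_forall]
    intro k hk
    rcases pentagonal_mod_five k with h | ⟨l, -, h⟩
    · omega
    · exact hn ⟨-l, by omega⟩

/-- The reciprocal of Euler's product: the generating function of the partitions. -/
noncomputable def partitionSeries : ℤ⟦X⟧ := mk fun n => (Fintype.card n.Partition : ℤ)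

theorem pentagonalSeries_mul_partitionSeries : pentagonalSeries ℤ * partitionSeries = 1 := by
  rw [mul_comm]
  exact mk_card_partition_mul_pentagonalSeries

/-- With sections a, b, c, 0, 0 of E, section 2 of E³ is 3a(ac + b²). It vanishes, and a has nonzero
constant term, so ac = -b². -/
theorem sect_zero_mul_sect_two_pentagonalSeries :
    sect 0 (pentagonalSeries ℤ) * sect 2 (pentagonalSeries ℤ) =
      -expand5 (pentagonalSeries ℤ) ^ 2 := by
  have h := sect_two_pentagonalSeries_cube
  rw [pow_succ, pow_two, sect_two_mul, sect_zero_mul, sect_one_mul, sect_two_mul,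
    sect_three_pentagonalSeries, sect_four_pentagonalSeries, sect_one_pentagonalSeries] at h
  have h0 : sect 0 (pentagonalSeries ℤ) ≠ 0 := by
    intro h0
    have h1 := congrArg constantCoeff h0
    rw [← coeff_zero_eq_constantCoeff_apply, coeff_sect] at h1
    have := coeff_pentagonalSeries_pentagonal ℤ 0
    simp [pentagonal_def] at this
    rw [show 5 * 0 + 0 = 0 from rfl, coeff_zero_eq_constantCoeff_apply, this] at h1
    simp at h1
  have h3 : (3 : ℤ⟦X⟧) * sect 0 (pentagonalSeries ℤ) ≠ 0 := by
    refine mul_ne_zero ?_ h0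
    intro h3
    have := congrArg constantCoeff h3
    rw [show constantCoeff (3 : ℤ⟦X⟧) = 3 from map_ofNat _ 3, map_zero] at this
    omega
  apply mul_left_cancel₀ h3
  linear_combination h

/-- The Rogers-Ramanujan quotient `∏ (1 - X⁵ⁿ⁺²)(1 - X⁵ⁿ⁺³) / ((1 - X⁵ⁿ⁺¹)(1 - X⁵ⁿ⁺⁴))`, obtained
from the section of Euler's product. -/
noncomputable def rrSeries : ℤ⟦X⟧ := sect 0 (pentagonalSeries ℤ) * expand5 partitionSeries

/-- The inverse of `rrSeries`. -/
noncomputable def rrInv : ℤ⟦X⟧ := -(sect 2 (pentagonalSeries ℤ) * expand5 partitionSeries)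

theorem expand5_pentagonalSeries_mul :
    expand5 (pentagonalSeries ℤ) * expand5 partitionSeries = 1 := by
  rw [← map_mul, pentagonalSeries_mul_partitionSeries, map_one]

theorem rrSeries_mul_rrInv : rrSeries * rrInv = 1 := by
  rw [rrSeries, rrInv]
  linear_combination (-(expand5 partitionSeries) ^ 2) * sect_zero_mul_sect_two_pentagonalSeries +
    (1 + expand5 (pentagonalSeries ℤ) * expand5 partitionSeries) * expand5_pentagonalSeries_mul

theorem sect_zero_pentagonalSeries :
    sect 0 (pentagonalSeries ℤ) = expand5 (pentagonalSeries ℤ) * rrSeries := by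
  rw [rrSeries]
  linear_combination (-sect 0 (pentagonalSeries ℤ)) * expand5_pentagonalSeries_mul

theorem sect_two_pentagonalSeries :
    sect 2 (pentagonalSeries ℤ) = -(expand5 (pentagonalSeries ℤ) * rrInv) := by
  rw [rrInv]
  linear_combination (-sect 2 (pentagonalSeries ℤ)) * expand5_pentagonalSeries_mul

theorem pentagonalSeries_eq_dissection :
    pentagonalSeries ℤ = expand5 (expand5 (pentagonalSeries ℤ)) *
      (expand5 rrSeries - X - X ^ 2 * expand5 rrInv) := by
  conv_lhs => rw [eq_sum_sect (pentagonalSeries ℤ), sect_zero_pentagonalSeries,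
    sect_one_pentagonalSeries, sect_two_pentagonalSeries, sect_three_pentagonalSeries,
    sect_four_pentagonalSeries]
  simp only [map_neg, map_mul, map_zero]
  ring

theorem expand5_injective : Function.Injective (expand5 : ℤ⟦X⟧ → ℤ⟦X⟧) := fun f g h => by
  rw [← sect_expand5_zero f, h, sect_expand5_zero]

/-! ### Norm identities for fifth roots of unity -/

section RootsOfUnity
variable {A : Type*} [CommRing A] {ω : A}

theorem pow_five_of_sum (hω : 1 + ω + ω ^ 2 + ω ^ 3 + ω ^ 4 = 0) : ω ^ 5 = 1 := by
  linear_combination (ω - 1) * hω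

theorem prod_one_sub_pow_mul (hω : 1 + ω + ω ^ 2 + ω ^ 3 + ω ^ 4 = 0) (y : A) :
    (1 - y) * (1 - ω * y) * (1 - ω ^ 2 * y) * (1 - ω ^ 3 * y) * (1 - ω ^ 4 * y) = 1 - y ^ 5 := by
  have h5 := pow_five_of_sum hω
  have e1 : (1 - ω * y) * (1 - ω ^ 4 * y) = 1 - (ω + ω ^ 4) * y + y ^ 2 := by
    linear_combination y ^ 2 * h5
  have e2 : (1 - ω ^ 2 * y) * (1 - ω ^ 3 * y) = 1 - (ω ^ 2 + ω ^ 3) * y + y ^ 2 := by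
    linear_combination y ^ 2 * h5
  have hd : ω ^ 2 + ω ^ 3 = -1 - (ω + ω ^ 4) := by linear_combination hω
  have hc : (ω + ω ^ 4) * (-1 - (ω + ω ^ 4)) = -1 := by
    rw [← hd]
    linear_combination hω + (ω + ω ^ 2) * h5
  rw [show (1 - y) * (1 - ω * y) * (1 - ω ^ 2 * y) * (1 - ω ^ 3 * y) * (1 - ω ^ 4 * y) =
    (1 - y) * ((1 - ω * y) * (1 - ω ^ 4 * y)) * ((1 - ω ^ 2 * y) * (1 - ω ^ 3 * y)) by ring,
    e1, e2, hd]
  linear_combination (1 - y) * y ^ 2 * hc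

/-- Pairing ω with ω⁴ and ω² with ω³ leaves quadratics in x - v and y. Their coefficients involve c
= ω + ω⁴ and its conjugate -1 - c, whose product is -1. -/
theorem prod_sub_pow_mul_sub (hω : 1 + ω + ω ^ 2 + ω ^ 3 + ω ^ 4 = 0) {x v y : A}
    (h : x * v = y ^ 2) :
    (x - y - v) * (x - ω * y - ω ^ 2 * v) * (x - ω ^ 2 * y - ω ^ 4 * v) *
      (x - ω ^ 3 * y - ω ^ 6 * v) * (x - ω ^ 4 * y - ω ^ 8 * v) = x ^ 5 - 11 * y ^ 5 - v ^ 5 := by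
  have h5 := pow_five_of_sum hω
  have h6 : ω ^ 6 = ω := by linear_combination ω * h5
  have h8 : ω ^ 8 = ω ^ 3 := by linear_combination ω ^ 3 * h5
  have hd : ω ^ 2 + ω ^ 3 = -1 - (ω + ω ^ 4) := by linear_combination hω
  have hc : (ω + ω ^ 4) * (-1 - (ω + ω ^ 4)) = -1 := by
    rw [← hd]
    linear_combination hω + (ω + ω ^ 2) * h5
  have e1 : (x - ω * y - ω ^ 2 * v) * (x - ω ^ 4 * y - ω ^ 3 * v) =
      (x - v) ^ 2 - (ω + ω ^ 4) * y * (x - v) + (4 + (ω + ω ^ 4)) * y ^ 2 := by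
    linear_combination (y ^ 2 + ω * y * v + v ^ 2) * h5 + (2 - ω ^ 2 - ω ^ 3) * h - y ^ 2 * hd
  have e2 : (x - ω ^ 2 * y - ω ^ 4 * v) * (x - ω ^ 3 * y - ω * v) =
      (x - v) ^ 2 - (-1 - (ω + ω ^ 4)) * y * (x - v) + (4 + (-1 - (ω + ω ^ 4))) * y ^ 2 := by
    rw [← hd]
    linear_combination (y ^ 2 + ω ^ 2 * y * v + v ^ 2) * h5 + (2 - ω - ω ^ 4) * h + y ^ 2 * hd -
      2 * y ^ 2 * hω
  rw [h6, h8, show (x - y - v) * (x - ω * y - ω ^ 2 * v) * (x - ω ^ 2 * y - ω ^ 4 * v) *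
      (x - ω ^ 3 * y - ω * v) * (x - ω ^ 4 * y - ω ^ 3 * v) =
    (x - v - y) * ((x - ω * y - ω ^ 2 * v) * (x - ω ^ 4 * y - ω ^ 3 * v)) *
      ((x - ω ^ 2 * y - ω ^ 4 * v) * (x - ω ^ 3 * y - ω * v)) by ring, e1, e2,
    show x ^ 5 - 11 * y ^ 5 - v ^ 5 = (x - v) ^ 5 + 5 * (x * v) * (x - v) ^ 3 +
      5 * (x * v) ^ 2 * (x - v) - 11 * y ^ 5 by ring, h]
  generalize ω + ω ^ 4 = c at hc
  generalize x - v = s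
  linear_combination (s - y) * (y ^ 2 * s ^ 2 - 2 * y ^ 3 * s + y ^ 4) * hc

end RootsOfUnity

end Euler

/-! ### The norm of Euler's product -/

section Norm

theorem rescale_expand5 {A : Type*} [CommRing A] {ω : A} (hω : ω ^ 5 = 1) (f : A⟦X⟧) :
    rescale ω (expand5 f) = expand5 f := by
  ext n
  rw [coeff_rescale]
  by_cases h : 5 ∣ n
  · obtain ⟨m, rfl⟩ := h
    rw [pow_mul, hω, one_pow, one_mul]
  · rw [coeff_expand_of_not_dvd _ _ _ h, mul_zero]

theorem rescale_qFac {A : Type*} [CommRing A] (ω : A) (n : ℕ) :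
    rescale ω (qFac X n) = qFac (C ω * X) n := by
  rw [qFac_map, rescale_X]

section
variable {A : Type*} [CommRing A] {ω : A}

theorem geom_sum_pow_eq_zero_or (hω : 1 + ω + ω ^ 2 + ω ^ 3 + ω ^ 4 = 0) (n : ℕ) :
    (1 + ω ^ n + (ω ^ n) ^ 2 + (ω ^ n) ^ 3 + (ω ^ n) ^ 4 = 0) ∨ 5 ∣ n := by
  have h5 := pow_five_of_sum hω
  have hn : ω ^ n = ω ^ (n % 5) := by
    conv_lhs => rw [← Nat.div_add_mod n 5, pow_add, pow_mul, h5, one_pow, one_mul]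
  rw [hn]
  have h4 : n % 5 < 5 := Nat.mod_lt _ (by norm_num)
  rw [Nat.dvd_iff_mod_eq_zero]
  generalize n % 5 = r at *
  interval_cases r
  · exact Or.inr rfl
  · left; linear_combination hω
  · left; linear_combination hω + (ω + ω ^ 3) * h5
  · left; linear_combination hω + (ω + ω ^ 4 + ω ^ 2 * (ω ^ 5 + 1)) * h5
  · left
    linear_combination hω + (ω ^ 3 + ω ^ 2 * (ω ^ 5 + 1) + ω * (ω ^ 10 + ω ^ 5 + 1)) * h5

/-- The product of the five conjugates of `qFac y n` under `y ↦ ω y`. -/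
def qFacNorm (ω y : A) (n : ℕ) : A :=
  qFac y n * qFac (ω * y) n * qFac (ω ^ 2 * y) n * qFac (ω ^ 3 * y) n * qFac (ω ^ 4 * y) n

theorem qFacNorm_succ (hω : 1 + ω + ω ^ 2 + ω ^ 3 + ω ^ 4 = 0) (y : A) (n : ℕ) :
    qFacNorm ω y (n + 1) = qFacNorm ω y n *
      if 5 ∣ n + 1 then (1 - y ^ (n + 1)) ^ 5 else 1 - (y ^ (n + 1)) ^ 5 := by
  have h : qFacNorm ω y (n + 1) = qFacNorm ω y n * ((1 - y ^ (n + 1)) *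
      (1 - ω ^ (n + 1) * y ^ (n + 1)) * (1 - (ω ^ (n + 1)) ^ 2 * y ^ (n + 1)) *
      (1 - (ω ^ (n + 1)) ^ 3 * y ^ (n + 1)) * (1 - (ω ^ (n + 1)) ^ 4 * y ^ (n + 1))) := by
    simp only [qFacNorm, qFac_succ, mul_pow, pow_right_comm ω _ (n + 1)]
    generalize 1 - y ^ (n + 1) = u0
    generalize 1 - ω ^ (n + 1) * y ^ (n + 1) = u1
    generalize 1 - (ω ^ (n + 1)) ^ 2 * y ^ (n + 1) = u2
    generalize 1 - (ω ^ (n + 1)) ^ 3 * y ^ (n + 1) = u3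
    generalize 1 - (ω ^ (n + 1)) ^ 4 * y ^ (n + 1) = u4
    ring
  rw [h]
  split_ifs with hd
  · obtain ⟨k, hk⟩ := hd
    rw [hk, pow_mul ω, pow_five_of_sum hω, one_pow]
    ring
  · rw [prod_one_sub_pow_mul ((geom_sum_pow_eq_zero_or hω (n + 1)).resolve_right hd)]

/-- An index k prime to 5 has norm 1 - y^(5k), while k = 5j gives (1 - y^(5j))^5. The factor `qFac
(y ^ 25) m` supplies the terms 1 - y^(25j) missing from `qFac (y ^ 5) (5 * m)`. -/
theorem qFacNorm_mul_qFac (hω : 1 + ω + ω ^ 2 + ω ^ 3 + ω ^ 4 = 0) (y : A) (m : ℕ) :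
    qFacNorm ω y (5 * m) * qFac (y ^ 25) m = qFac (y ^ 5) (5 * m) * qFac (y ^ 5) m ^ 5 := by
  induction m with
  | zero => simp [qFac, qFacNorm]
  | succ m ih =>
    rw [show 5 * (m + 1) = 5 * m + 1 + 1 + 1 + 1 + 1 by ring]
    rw [qFacNorm_succ hω, qFacNorm_succ hω, qFacNorm_succ hω, qFacNorm_succ hω, qFacNorm_succ hω,
      if_neg (show ¬ 5 ∣ 5 * m + 1 by omega), if_neg (show ¬ 5 ∣ 5 * m + 1 + 1 by omega),
      if_neg (show ¬ 5 ∣ 5 * m + 1 + 1 + 1 by omega),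
      if_neg (show ¬ 5 ∣ 5 * m + 1 + 1 + 1 + 1 by omega),
      if_pos (show 5 ∣ 5 * m + 1 + 1 + 1 + 1 + 1 by omega)]
    simp only [qFac_succ, ← pow_mul, mul_comm _ 5]
    rw [show 25 * (m + 1) = 5 * (5 * m + 1 + 1 + 1 + 1 + 1) by ring,
      show 5 * (m + 1) = 5 * m + 1 + 1 + 1 + 1 + 1 by ring]
    generalize 1 - y ^ (5 * (5 * m + 1)) = u1
    generalize 1 - y ^ (5 * (5 * m + 1 + 1)) = u2
    generalize 1 - y ^ (5 * (5 * m + 1 + 1 + 1)) = u3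
    generalize 1 - y ^ (5 * (5 * m + 1 + 1 + 1 + 1)) = u4
    generalize 1 - y ^ (5 * (5 * m + 1 + 1 + 1 + 1 + 1)) = u5
    generalize 1 - y ^ (5 * m + 1 + 1 + 1 + 1 + 1) = u6
    linear_combination u1 * u2 * u3 * u4 * u5 * u6 ^ 5 * ih

end

theorem dvd_rescale_sub {A : Type*} [CommRing A] (ω : A) (n : ℕ) :
    (X : A⟦X⟧) ^ (n + 1) ∣ rescale ω (pentagonalSeries A) - qFac (C ω * X) n := by
  have h := map_dvd (rescale ω) (dvd_pentagonalSeries_sub_qFac (R := A) n)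
  rw [map_pow, map_sub, rescale_X, mul_pow, rescale_qFac] at h
  exact (dvd_mul_left _ _).trans h

/-- The product of the five conjugates of Euler's product. -/
theorem prod_rescale_pentagonalSeries {A : Type*} [CommRing A] {ω : A}
    (hω : 1 + ω + ω ^ 2 + ω ^ 3 + ω ^ 4 = 0) :
    rescale 1 (pentagonalSeries A) * rescale ω (pentagonalSeries A) *
      rescale (ω ^ 2) (pentagonalSeries A) * rescale (ω ^ 3) (pentagonalSeries A) *
      rescale (ω ^ 4) (pentagonalSeries A) * expand5 (expand5 (pentagonalSeries A)) =
      expand5 (pentagonalSeries A) ^ 6 := by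
  have hexp : ∀ k, (X : A⟦X⟧) ^ (k + 1) ∣ expand5 (pentagonalSeries A) - qFac (X ^ 5) k := by
    intro k
    have h := map_dvd expand5 (dvd_pentagonalSeries_sub_qFac (R := A) k)
    rw [map_pow, map_sub, expand_X, ← pow_mul, show expand5 (qFac (X : A⟦X⟧) k) =
      (expand5 : A⟦X⟧ →ₐ[A] A⟦X⟧).toRingHom (qFac X k) from rfl, qFac_map] at h
    refine (pow_dvd_pow X (by omega)).trans (h.trans ?_)
    simp
  have hexp2 : ∀ k, (X : A⟦X⟧) ^ (5 * k + 1) ∣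
      expand5 (expand5 (pentagonalSeries A)) - qFac (X ^ 25) k := by
    intro k
    have h := map_dvd expand5 (hexp k)
    rw [map_pow, map_sub, expand_X, ← pow_mul, show expand5 (qFac ((X : A⟦X⟧) ^ 5) k) =
      (expand5 : A⟦X⟧ →ₐ[A] A⟦X⟧).toRingHom (qFac (X ^ 5) k) from rfl, qFac_map] at h
    refine (pow_dvd_pow X (by omega)).trans (h.trans ?_)
    simp [← pow_mul]
  have hexp1 : ∀ k, (X : A⟦X⟧) ^ (5 * k + 1) ∣
      expand5 (pentagonalSeries A) - qFac (X ^ 5) k := by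
    intro k
    have h := map_dvd expand5 (dvd_pentagonalSeries_sub_qFac (R := A) k)
    rw [map_pow, map_sub, expand_X, ← pow_mul, show expand5 (qFac (X : A⟦X⟧) k) =
      (expand5 : A⟦X⟧ →ₐ[A] A⟦X⟧).toRingHom (qFac X k) from rfl, qFac_map] at h
    refine (pow_dvd_pow X (by omega)).trans (h.trans ?_)
    simp
  have hC : 1 + C ω + C ω ^ 2 + C ω ^ 3 + C ω ^ 4 = (0 : A⟦X⟧) := by
    simp only [← map_pow, ← map_add, ← map_one (C : A →+* A⟦X⟧), hω, map_zero]
  ext n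
  have hfin := qFacNorm_mul_qFac hC X (n + 1)
  have h0 := dvd_rescale_sub (1 : A) (5 * (n + 1))
  have h1 := dvd_rescale_sub ω (5 * (n + 1))
  have h2 := dvd_rescale_sub (ω ^ 2) (5 * (n + 1))
  have h3 := dvd_rescale_sub (ω ^ 3) (5 * (n + 1))
  have h4 := dvd_rescale_sub (ω ^ 4) (5 * (n + 1))
  rw [map_one, one_mul] at h0
  rw [map_pow] at h2 h3 h4
  have hL := dvd_mul_sub_mul (dvd_mul_sub_mul (dvd_mul_sub_mul (dvd_mul_sub_mul
    (dvd_mul_sub_mul h0 h1) h2) h3) h4) (hexp2 (n + 1))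
  have hs := hexp1 (n + 1)
  have hR := dvd_mul_sub_mul (hexp (5 * (n + 1))) (dvd_mul_sub_mul (dvd_mul_sub_mul
    (dvd_mul_sub_mul (dvd_mul_sub_mul hs hs) hs) hs) hs)
  rw [qFacNorm] at hfin
  rw [hfin] at hL
  have h := dvd_sub hL hR
  rw [sub_sub_sub_comm] at h
  have h' := X_pow_dvd_iff.1 h n (by omega)
  have e : ∀ u v : A⟦X⟧, u * v ^ 5 - u * (v * v * v * v * v) = 0 := fun u v => by ring
  rw [e, sub_zero, map_sub, sub_eq_zero] at h'
  rw [h']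
  congr 1
  ring

/-- The fundamental relation between Euler's product and the Rogers-Ramanujan quotient. -/
theorem pentagonalSeries_pow_six :
    pentagonalSeries ℤ ^ 6 = expand5 (pentagonalSeries ℤ) ^ 6 *
      (rrSeries ^ 5 - 11 * X - X ^ 2 * rrInv ^ 5) := by
  apply expand5_injective
  have hinj : Function.Injective (map (Int.castRingHom ℂ)) :=
    PowerSeries.map_injective _ Int.cast_injective
  apply hinj
  obtain ⟨ω, hω⟩ : ∃ ω : ℂ, 1 + ω + ω ^ 2 + ω ^ 3 + ω ^ 4 = 0 := by
    have h := (Complex.isPrimitiveRoot_exp 5 (by norm_num)).geom_sum_eq_zero (by norm_num)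
    refine ⟨Complex.exp (2 * Real.pi * Complex.I / (5 : ℕ)), ?_⟩
    simpa [Finset.sum_range_succ] using h
  have h5 := pow_five_of_sum hω
  have hprod := prod_rescale_pentagonalSeries hω
  have hd := congrArg (map (Int.castRingHom ℂ)) pentagonalSeries_eq_dissection
  simp only [map_mul, map_sub, map_pow, map_expand, map_pentagonalSeries, map_X] at hd ⊢
  set x := map (Int.castRingHom ℂ) rrSeries with hx
  set v := map (Int.castRingHom ℂ) rrInv with hv
  have hxv : x * v = 1 := by
    rw [hx, hv, ← map_mul, rrSeries_mul_rrInv, map_one]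
  set F := pentagonalSeries ℂ with hF
  -- Replacing X by ω^j X fixes all series in X^5, so the five conjugates of the dissection differ
  -- only through the explicit X and X².
  have hres : ∀ j : ℕ, rescale (ω ^ j) F = expand5 (expand5 F) *
      (expand5 x - C ω ^ j * X - C ω ^ (2 * j) * (X ^ 2 * expand5 v)) := by
    intro j
    have hj : (ω ^ j) ^ 5 = 1 := by rw [pow_right_comm, h5, one_pow]
    conv_lhs => rw [hd]
    rw [map_mul, map_sub, map_sub, map_mul, map_pow, rescale_X, rescale_expand5 hj,
      rescale_expand5 hj, rescale_expand5 hj, map_pow]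
    ring
  have hC : 1 + C ω + C ω ^ 2 + C ω ^ 3 + C ω ^ 4 = (0 : ℂ⟦X⟧) := by
    simp only [← map_pow, ← map_add, ← map_one (C : ℂ →+* ℂ⟦X⟧), hω, map_zero]
  have hxv5 : expand5 x * (X ^ 2 * expand5 v) = X ^ 2 := by
    rw [mul_left_comm, ← map_mul, hxv, map_one, mul_one]
  have hpr := prod_sub_pow_mul_sub hC hxv5
  have r0 := hres 0
  have r1 := hres 1
  rw [pow_zero] at r0
  rw [pow_one] at r1
  rw [r0, r1, hres 2, hres 3, hres 4] at hprod
  rw [← hprod, map_ofNat, map_ofNat, expand_X]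
  linear_combination (expand5 (expand5 F)) ^ 6 * hpr

end Norm

/-! ### Sections of P, of E³ and of their images under X ↦ X³ -/

section Dissection
set_option linter.unusedSimpArgs false

/-- The series `rrSeries ^ 5 - 11 X - X ^ 2 rrSeries ^ (-5)`. -/
noncomputable def rrNorm : ℤ⟦X⟧ := rrSeries ^ 5 - 11 * X - X ^ 2 * rrInv ^ 5

/-- The common factor of the five sections of the generating function of the partitions. -/
noncomputable def sectUnit : ℤ⟦X⟧ := partitionSeries ^ 6 * expand5 (pentagonalSeries ℤ) ^ 5

theorem expand5_mul_sectUnit_mul_rrNorm :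
    expand5 (pentagonalSeries ℤ) * sectUnit * rrNorm = 1 := by
  have h := pentagonalSeries_pow_six
  have h1 := congrArg (· ^ 6) pentagonalSeries_mul_partitionSeries
  rw [sectUnit, rrNorm]
  simp only [mul_pow, one_pow] at h1
  linear_combination h1 - partitionSeries ^ 6 * h

theorem sectUnit_mul_rrNorm : sectUnit * rrNorm = expand5 partitionSeries := by
  linear_combination expand5 partitionSeries * expand5_mul_sectUnit_mul_rrNorm -
    sectUnit * rrNorm * expand5_pentagonalSeries_mul

theorem sect_of_eq_sum {R : Type*} [CommRing R] {f a b c d e : R⟦X⟧}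
    (h : f = expand5 a + X * (expand5 b + X * (expand5 c + X * (expand5 d + X * expand5 e)))) :
    sect 0 f = a ∧ sect 1 f = b ∧ sect 2 f = c ∧ sect 3 f = d ∧ sect 4 f = e := by
  subst h
  simp only [map_add, sect_zero_X_mul, sect_one_X_mul, sect_two_X_mul, sect_three_X_mul,
    sect_four_X_mul, sect_expand5_zero, sect_expand5_of_pos (zero_lt_one) (by norm_num : 1 < 5),
    sect_expand5_of_pos (zero_lt_two) (by norm_num : 2 < 5),
    sect_expand5_of_pos (zero_lt_three) (by norm_num : 3 < 5),
    sect_expand5_of_pos (zero_lt_four) (by norm_num : 4 < 5), mul_zero, add_zero, zero_add,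
    and_self]

theorem sect_partitionSeries :
    sect 0 partitionSeries = sectUnit * (rrSeries ^ 4 - 3 * X * rrInv) ∧
    sect 1 partitionSeries = sectUnit * (rrSeries ^ 3 + 2 * X * rrInv ^ 2) ∧
    sect 2 partitionSeries = sectUnit * (2 * rrSeries ^ 2 - X * rrInv ^ 3) ∧
    sect 3 partitionSeries = sectUnit * (3 * rrSeries + X * rrInv ^ 4) ∧
    sect 4 partitionSeries = sectUnit * 5 := by
  apply sect_of_eq_sum
  have hE := pentagonalSeries_eq_dissection
  have hI := pentagonalSeries_mul_partitionSeries
  have hU := congrArg expand5 expand5_mul_sectUnit_mul_rrNorm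
  have hxv := congrArg expand5 rrSeries_mul_rrInv
  rw [rrNorm] at hU
  simp only [map_mul, map_sub, map_pow, map_ofNat, expand_X, map_one, map_add] at hU hxv ⊢
  rw [hE] at hI
  generalize expand5 rrSeries = x at *
  generalize expand5 rrInv = v at *
  generalize expand5 sectUnit = M at *
  generalize expand5 (expand5 (pentagonalSeries ℤ)) = F at *
  -- The second factor is the product of the other four conjugates of x - X - X²v. It rationalises
  -- 1/E, and its terms grouped by exponent modulo 5 are the claimed sections.
  have inv : (x - X - X ^ 2 * v) * ((x ^ 4 - 3 * X ^ 5 * v) + X * (x ^ 3 + 2 * X ^ 5 * v ^ 2) +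
      X ^ 2 * (2 * x ^ 2 - X ^ 5 * v ^ 3) + X ^ 3 * (3 * x + X ^ 5 * v ^ 4) + 5 * X ^ 4) =
      x ^ 5 - 11 * X ^ 5 - (X ^ 5) ^ 2 * v ^ 5 := by
    linear_combination (v ^ 3 * X ^ 8 - v ^ 2 * X ^ 7 + 2 * v * X ^ 6 - 6 * X ^ 5 - 2 * x * X ^ 4 -
      x ^ 2 * X ^ 3 - x ^ 3 * X ^ 2) * hxv
  generalize hJ : (x ^ 4 - 3 * X ^ 5 * v) + X * (x ^ 3 + 2 * X ^ 5 * v ^ 2) +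
      X ^ 2 * (2 * x ^ 2 - X ^ 5 * v ^ 3) + X ^ 3 * (3 * x + X ^ 5 * v ^ 4) + 5 * X ^ 4 = J at inv
  linear_combination (-partitionSeries) * hU - F * M * partitionSeries * inv + M * J * hI - M * hJ

theorem sect_pentagonalSeries_cube :
    sect 0 (pentagonalSeries ℤ ^ 3) =
      expand5 (pentagonalSeries ℤ) ^ 3 * (rrSeries ^ 3 - 3 * X * rrInv ^ 2) ∧
    sect 1 (pentagonalSeries ℤ ^ 3) =
      expand5 (pentagonalSeries ℤ) ^ 3 * (-3 * rrSeries ^ 2 - X * rrInv ^ 3) ∧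
    sect 2 (pentagonalSeries ℤ ^ 3) = 0 ∧
    sect 3 (pentagonalSeries ℤ ^ 3) = 5 * expand5 (pentagonalSeries ℤ) ^ 3 ∧
    sect 4 (pentagonalSeries ℤ ^ 3) = 0 := by
  apply sect_of_eq_sum
  have hxv := congrArg expand5 rrSeries_mul_rrInv
  conv_lhs => rw [pentagonalSeries_eq_dissection]
  simp only [map_mul, map_sub, map_pow, map_ofNat, expand_X, map_one, map_zero, map_neg] at hxv ⊢
  generalize expand5 rrSeries = x at *
  generalize expand5 rrInv = v at *
  generalize expand5 (expand5 (pentagonalSeries ℤ)) = F at *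
  linear_combination F ^ 3 * (3 * X ^ 4 * v - 3 * X ^ 2 * x + 6 * X ^ 3) * hxv

theorem sect_two_pentagonalSeries_sq :
    sect 2 (pentagonalSeries ℤ ^ 2) = -expand5 (pentagonalSeries ℤ) ^ 2 := by
  rw [pow_two, sect_two_mul, sect_three_pentagonalSeries, sect_four_pentagonalSeries,
    sect_one_pentagonalSeries]
  linear_combination 2 * sect_zero_mul_sect_two_pentagonalSeries

theorem sect_expand3_partitionSeries :
    sect 0 (expand3 partitionSeries) = expand3 sectUnit *
      (expand3 rrSeries ^ 4 - 3 * X ^ 3 * expand3 rrInv) ∧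
    sect 1 (expand3 partitionSeries) = expand3 sectUnit *
      (X * (2 * expand3 rrSeries ^ 2 - X ^ 3 * expand3 rrInv ^ 3)) ∧
    sect 2 (expand3 partitionSeries) = expand3 sectUnit * (5 * X ^ 2) ∧
    sect 3 (expand3 partitionSeries) = expand3 sectUnit *
      (expand3 rrSeries ^ 3 + 2 * X ^ 3 * expand3 rrInv ^ 2) ∧
    sect 4 (expand3 partitionSeries) = expand3 sectUnit *
      (X * (3 * expand3 rrSeries + X ^ 3 * expand3 rrInv ^ 4)) := by
  obtain ⟨h0, h1, h2, h3, h4⟩ := sect_partitionSeries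
  refine ⟨?_, ?_, ?_, ?_, ?_⟩
  · rw [sect_zero_expand3, h0]
    simp only [map_mul, map_add, map_sub, map_pow, map_neg, map_ofNat, expand_X]
  · rw [sect_one_expand3, h2]
    simp only [map_mul, map_add, map_sub, map_pow, map_neg, map_ofNat, expand_X]
    ring
  · rw [sect_two_expand3, h4]
    simp only [map_mul, map_add, map_sub, map_pow, map_neg, map_ofNat, expand_X]
    ring
  · rw [sect_three_expand3, h1]
    simp only [map_mul, map_add, map_sub, map_pow, map_neg, map_ofNat, expand_X]
  · rw [sect_four_expand3, h3]
    simp only [map_mul, map_add, map_sub, map_pow, map_neg, map_ofNat, expand_X]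
    ring

theorem sect_expand3_pentagonalSeries_cube :
    sect 0 (expand3 (pentagonalSeries ℤ) ^ 3) = expand3 (expand5 (pentagonalSeries ℤ)) ^ 3 *
      (expand3 rrSeries ^ 3 - 3 * X ^ 3 * expand3 rrInv ^ 2) ∧
    sect 1 (expand3 (pentagonalSeries ℤ) ^ 3) = 0 ∧
    sect 2 (expand3 (pentagonalSeries ℤ) ^ 3) = 0 ∧
    sect 3 (expand3 (pentagonalSeries ℤ) ^ 3) = expand3 (expand5 (pentagonalSeries ℤ)) ^ 3 *
      (-3 * expand3 rrSeries ^ 2 - X ^ 3 * expand3 rrInv ^ 3) ∧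
    sect 4 (expand3 (pentagonalSeries ℤ) ^ 3) =
      expand3 (expand5 (pentagonalSeries ℤ)) ^ 3 * (5 * X) := by
  obtain ⟨h0, h1, h2, h3, h4⟩ := sect_pentagonalSeries_cube
  rw [← map_pow]
  refine ⟨?_, ?_, ?_, ?_, ?_⟩
  · rw [sect_zero_expand3, h0]
    simp only [map_mul, map_add, map_sub, map_pow, map_neg, map_ofNat, expand_X]
  · rw [sect_one_expand3, h2, map_zero, mul_zero]
  · rw [sect_two_expand3, h4, map_zero, mul_zero]
  · rw [sect_three_expand3, h1]
    simp only [map_mul, map_add, map_sub, map_pow, map_neg, map_ofNat, expand_X]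
  · rw [sect_four_expand3, h3]
    simp only [map_mul, map_add, map_sub, map_pow, map_neg, map_ofNat, expand_X]
    ring

end Dissection

/-! ### The relation between R(X) and R(X³), and its algebraic consequences -/

section Relation
set_option linter.unusedSimpArgs false

/-- Here q, x, y stand for X, R(X), R(X³), and v, w for the inverses of x, y. The left side is what
the self-similarity of the 3-core series forces to vanish; it factors, and the first factor is the
wanted relation. -/
theorem core_dissection_eq {R : Type*} [CommRing R] {q x v y w : R} (hxv : x * v = 1)
    (hyw : y * w = 1) :
    (x ^ 4 - 3 * q * v) * (-3 * y ^ 2 - q ^ 3 * w ^ 3) + (3 * x + q * v ^ 4) *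
      (y ^ 3 - 3 * q ^ 3 * w ^ 2) + 25 * q ^ 2 - q * (x ^ 5 - 11 * q - q ^ 2 * v ^ 5) =
    (x ^ 2 * y - q ^ 2 * v ^ 2 * w - v * y ^ 2 + q ^ 2 * x * w ^ 2 - 3 * q) *
      (3 * v ^ 2 * w * q ^ 2 - v ^ 3 * y * q - x ^ 3 * w * q - 3 * x ^ 2 * y - 10 * q) := by
  linear_combination (-3 * v * w ^ 3 * q ^ 4 + v ^ 2 * y * w ^ 2 * q ^ 3 - x ^ 2 * v * w ^ 2 *
    q ^ 3 - x * w ^ 2 * q ^ 3 - 6 * x * v * y * w * q ^ 2 + x * v ^ 2 * y ^ 2 * q - x ^ 2 * y ^ 2 *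
    w * q - 6 * y * w * q ^ 2 + v * y ^ 2 * q - 3 * x * y ^ 3) * hxv + (-v ^ 5 * q ^ 3 + v ^ 2 * w *
    q ^ 3 + 3 * v ^ 3 * y * q ^ 2 + 3 * x ^ 3 * w * q ^ 2 + x ^ 5 * q - x ^ 2 * y * q - 6 * q ^ 2) *
    hyw

theorem cube_dissection_eq {R : Type*} [CommRing R] {q x v y w : R} (hxv : x * v = 1) (hyw : y * w
  = 1)
    (hR : x ^ 2 * y - q ^ 2 * v ^ 2 * w - v * y ^ 2 + q ^ 2 * x * w ^ 2 - 3 * q = 0) :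
    (x ^ 3 - 3 * q * v ^ 2) * (y ^ 4 - 3 * q ^ 3 * w) + q * ((-3 * x ^ 2 - q * v ^ 3) *
      (q * (3 * y + q ^ 3 * w ^ 4)) + 25 * q ^ 2) = y ^ 5 - 11 * q ^ 3 - q ^ 6 * w ^ 5 := by
  linear_combination (v * w ^ 3 * q ^ 4 - 3 * x * w ^ 2 * q ^ 3 + 3 * v * y ^ 2 * q + x * y ^ 3 -
    10 * q ^ 2) * hR + (-w ^ 5 * q ^ 6 - 3 * v * w ^ 3 * q ^ 5 - x * y * w ^ 3 * q ^ 4 - 6 * y ^ 2 *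
    w ^ 2 * q ^ 3 + v * y ^ 3 * w * q ^ 2 + y ^ 5 - 3 * x * y ^ 3 * q) * hxv +
    (v ^ 2 * y * w ^ 2 * q ^ 4 + v ^ 2 * w * q ^ 4 + 3 * v ^ 3 * y * q ^ 3 - x * w ^ 2 * q ^ 4 -
      x ^ 2 * y ^ 2 * w * q ^ 2 + 3 * x ^ 3 * w * q ^ 3 - 6 * y * w * q ^ 3 + v * y ^ 2 * q ^ 2 -
      x ^ 2 * y * q ^ 2 - 6 * q ^ 3) * hyw

/-- The left side is section 1 of P P_3 without its unit factors. Modulo 25 only the two norms, -5q³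
and 10q times one quadratic expression remain; the last is needed only modulo 5. -/
theorem partition_dissection_eq {R : Type*} [CommRing R] {q x v y w : R} (hxv : x * v = 1) (hyw :
  y * w = 1)
    (hR : x ^ 2 * y - q ^ 2 * v ^ 2 * w - v * y ^ 2 + q ^ 2 * x * w ^ 2 - 3 * q = 0) :
    q * (x ^ 4 - 3 * q * v) * (2 * y ^ 2 - q ^ 3 * w ^ 3) + (x ^ 3 + 2 * q * v ^ 2) *
      (y ^ 4 - 3 * q ^ 3 * w) + q * ((2 * x ^ 2 - q * v ^ 3) * (q * (3 * y + q ^ 3 * w ^ 4)) +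
      (3 * x + q * v ^ 4) * (y ^ 3 + 2 * q ^ 3 * w ^ 2) + 25 * q ^ 2) =
    q ^ 2 * (x ^ 5 - 11 * q - q ^ 2 * v ^ 5) + (y ^ 5 - 11 * q ^ 3 - q ^ 6 * w ^ 5) - 5 * q ^ 3 +
      10 * q * ((x ^ 2 * y - q ^ 2 * v ^ 2 * w) ^ 2 + 2 * q * (x ^ 2 * y - q ^ 2 * v ^ 2 * w) + 4
        * q ^ 2) +
      25 * (2 * v ^ 3 * w ^ 4 * q ^ 6 - 2 * w ^ 5 * q ^ 6 - 4 * v ^ 4 * w ^ 2 * q ^ 5 + 10 * v *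
        w ^ 3 * q ^ 5 - 2 * v ^ 4 * y ^ 3 * q ^ 2 - 2 * v ^ 5 * q ^ 4 - 8 * v ^ 2 * w * q ^ 4 - 10 *
        v ^ 3 * y * q ^ 3) := by
  linear_combination (51 * v * w ^ 3 * q ^ 4 - 92 * v ^ 2 * w * q ^ 3 - 51 * v ^ 3 * y * q ^ 2 + 2
    * x * w ^ 2 * q ^ 3 - x ^ 3 * w * q ^ 2 - 2 * v * y ^ 2 * q + x * y ^ 3 - 8 * x ^ 2 * y * q - 40
    * q ^ 2) * hR + (-51 * w ^ 5 * q ^ 6 + 94 * v * w ^ 3 * q ^ 5 + 51 * v ^ 2 * y * w ^ 2 * q ^ 4 -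
    51 * x * y * w ^ 3 * q ^ 4 - x ^ 2 * v * w ^ 2 * q ^ 4 + 4 * y ^ 2 * w ^ 2 * q ^ 3 + v * y ^ 3 *
    w * q ^ 2 - x * w ^ 2 * q ^ 4 + 104 * x * v * y * w * q ^ 3 + 51 * x * v ^ 2 * y ^ 2 * q ^ 2 -
    x ^ 2 * y ^ 2 * w * q ^ 2 + 104 * y * w * q ^ 3 + y ^ 5 + 51 * v * y ^ 2 * q ^ 2 - 6 * x * y ^ 3
    * q) * hxv +
    (51 * v ^ 2 * y * w ^ 2 * q ^ 4 - 51 * v ^ 5 * q ^ 4 + 102 * v ^ 2 * w * q ^ 4 - 94 * v ^ 3 *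
      y * q ^ 3 - 51 * x * w ^ 2 * q ^ 4 - x ^ 2 * y ^ 2 * w * q ^ 2 + 6 * x ^ 3 * w * q ^ 3 + x ^ 5
      * q ^ 2 + 4 * y * w * q ^ 3 + v * y ^ 2 * q ^ 2 - 2 * x ^ 2 * y * q ^ 2 + 108 * q ^ 3) * hyw

/-- Evaluates modulo 5 the quadratic expression left over in `partition_dissection_eq`: times both
norms it is a combination of their squares, so it becomes a combination of Euler quotients. -/
theorem quotient_norm_eq {R : Type*} [CommRing R] {q x v y w : R} (hxv : x * v = 1) (hyw : y * w =
  1)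
    (hR : x ^ 2 * y - q ^ 2 * v ^ 2 * w - v * y ^ 2 + q ^ 2 * x * w ^ 2 - 3 * q = 0) :
    ((x ^ 2 * y - q ^ 2 * v ^ 2 * w) ^ 2 + 2 * q * (x ^ 2 * y - q ^ 2 * v ^ 2 * w) + 4 * q ^ 2) *
      (x ^ 5 - 11 * q - q ^ 2 * v ^ 5) * (y ^ 5 - 11 * q ^ 3 - q ^ 6 * w ^ 5) =
      q ^ 4 * (x ^ 5 - 11 * q - q ^ 2 * v ^ 5) ^ 2 + (y ^ 5 - 11 * q ^ 3 - q ^ 6 * w ^ 5) ^ 2 +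
      5 * (-v ^ 7 * w ^ 6 * q ^ 11 + 2 * v ^ 4 * w ^ 7 * q ^ 11 - v * w ^ 8 * q ^ 11 + 2 * v ^ 9 *
        w ^ 2 * q ^ 9 - 3 * v ^ 2 * w ^ 6 * q ^ 10 + v ^ 6 * w ^ 3 * q ^ 9 - 5 * v ^ 7 * w * q ^ 8 +
        24 * v ^ 4 * w ^ 2 * q ^ 8 - v ^ 6 * y ^ 2 * q ^ 6 + 5 * x ^ 2 * w ^ 4 * q ^ 8 - x ^ 6 *
        w ^ 2 * q ^ 6 + x ^ 7 * y ^ 6 * q - 2 * x ^ 9 * y ^ 2 * q ^ 3 + v * w ^ 3 * q ^ 8 + v ^ 5 *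
        q ^ 7 - 2 * x ^ 4 * y ^ 7 * q - x ^ 6 * y ^ 3 * q ^ 3 - 5 * x ^ 7 * y * q ^ 4 - 50 * v ^ 2 *
        w * q ^ 7 + 5 * v ^ 2 * y ^ 4 * q ^ 4 + 4 * v ^ 3 * y * q ^ 6 - x * w ^ 2 * q ^ 7 + x *
        y ^ 8 * q - 3 * x ^ 2 * y ^ 6 * q ^ 2 + 4 * x ^ 3 * w * q ^ 6 + 24 * x ^ 4 * y ^ 2 * q ^ 4 -
        x ^ 5 * q ^ 5 + v * y ^ 2 * q ^ 5 + x * y ^ 3 * q ^ 4 + 50 * x ^ 2 * y * q ^ 5 + 2 * q ^ 6)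
        := by
  linear_combination (-v ^ 7 * w ^ 6 * q ^ 10 - v ^ 4 * w ^ 7 * q ^ 10 - v * w ^ 8 * q ^ 10 + 2 *
    v ^ 2 * w ^ 6 * q ^ 9 + v ^ 6 * w ^ 3 * q ^ 8 - v ^ 3 * w ^ 4 * q ^ 8 - v ^ 7 * w * q ^ 7 +
    v ^ 8 * y * q ^ 6 + v ^ 4 * w ^ 2 * q ^ 7 - 2 * v ^ 6 * y ^ 2 * q ^ 5 + 2 * x ^ 2 * w ^ 4 *
    q ^ 7 - 2 * x ^ 4 * w ^ 3 * q ^ 6 - 2 * x ^ 6 * w ^ 2 * q ^ 5 + x ^ 7 * y ^ 6 - x ^ 8 * w *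
    q ^ 4 + 2 * v ^ 4 * y ^ 3 * q ^ 4 + x ^ 4 * y ^ 7 - x ^ 6 * y ^ 3 * q ^ 2 - x ^ 7 * y * q ^ 3 -
    2 * v ^ 2 * w * q ^ 6 + 2 * v ^ 2 * y ^ 4 * q ^ 3 + v ^ 3 * y * q ^ 5 + x * w ^ 2 * q ^ 6 + x *
    y ^ 8 + 2 * x ^ 2 * y ^ 6 * q + x ^ 3 * w * q ^ 5 + x ^ 3 * y ^ 4 * q ^ 2 + x ^ 4 * y ^ 2 *
    q ^ 3 - v * y ^ 2 * q ^ 4 + 2 * x ^ 2 * y * q ^ 4) * hR + (v ^ 6 * w ^ 8 * q ^ 12 + v ^ 3 *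
    w ^ 9 * q ^ 12 - x * v ^ 6 * y * w ^ 6 * q ^ 10 - x ^ 4 * v ^ 3 * w ^ 7 * q ^ 10 + w ^ 10 *
    q ^ 12 - v ^ 5 * y * w ^ 6 * q ^ 10 + x * v ^ 3 * y * w ^ 7 * q ^ 10 - x ^ 3 * v ^ 2 * w ^ 7 *
    q ^ 10 + x ^ 3 * v ^ 4 * y ^ 2 * w ^ 5 * q ^ 8 + 2 * x ^ 6 * v * y * w ^ 6 * q ^ 8 - 2 * v *
    w ^ 8 * q ^ 11 + v ^ 2 * y * w ^ 7 * q ^ 10 - v ^ 5 * w ^ 5 * q ^ 10 + x * y * w ^ 8 * q ^ 10 +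
    2 * x * v ^ 4 * y * w ^ 5 * q ^ 9 - x ^ 2 * v * w ^ 7 * q ^ 10 + x ^ 2 * v ^ 3 * y ^ 2 * w ^ 5 *
    q ^ 8 + 2 * x ^ 4 * v * w ^ 6 * q ^ 9 + 2 * x ^ 5 * y * w ^ 6 * q ^ 8 + v ^ 2 * w ^ 6 * q ^ 10 +
    2 * v ^ 3 * y * w ^ 5 * q ^ 9 + v ^ 6 * w ^ 3 * q ^ 9 - v ^ 7 * y * w ^ 2 * q ^ 8 - x * w ^ 7 *
    q ^ 10 - 24 * x * v * y * w ^ 6 * q ^ 9 + x * v ^ 2 * y ^ 2 * w ^ 5 * q ^ 8 - x * v ^ 5 * y *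
    w ^ 3 * q ^ 8 + 2 * x * v ^ 6 * y ^ 6 * w * q ^ 4 + 2 * x ^ 3 * w ^ 6 * q ^ 9 + x ^ 4 * v ^ 3 *
    y ^ 5 * w ^ 2 * q ^ 4 - 24 * y * w ^ 6 * q ^ 9 + v * y ^ 2 * w ^ 5 * q ^ 8 - v ^ 3 * w ^ 4 *
    q ^ 9 - v ^ 4 * y * w ^ 3 * q ^ 8 + 2 * v ^ 5 * y ^ 2 * w ^ 2 * q ^ 7 + 2 * v ^ 5 * y ^ 6 * w *
    q ^ 4 + 2 * x * v * w ^ 5 * q ^ 9 + x * v ^ 2 * y * w ^ 4 * q ^ 8 - 21 * x * v ^ 6 * y * w *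
    q ^ 7 - x * v ^ 7 * y ^ 2 * q ^ 6 - 2 * x ^ 3 * v * w ^ 4 * q ^ 8 + x ^ 3 * v ^ 2 * y ^ 5 *
    w ^ 2 * q ^ 4 - x ^ 3 * v ^ 4 * y ^ 7 * q ^ 2 - 11 * x ^ 4 * v ^ 3 * w ^ 2 * q ^ 7 - 2 * x ^ 5 *
    v * w ^ 3 * q ^ 7 - x ^ 6 * v * y ^ 6 * w * q ^ 2 - x ^ 7 * v * w ^ 2 * q ^ 6 + 2 * w ^ 5 *
    q ^ 9 + v * y * w ^ 4 * q ^ 8 - 2 * v ^ 3 * y ^ 3 * w ^ 2 * q ^ 6 - 21 * v ^ 5 * y * w * q ^ 7 -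
    v ^ 6 * y ^ 2 * q ^ 6 + 2 * x * y ^ 2 * w ^ 4 * q ^ 7 - x * v ^ 3 * y * w ^ 2 * q ^ 7 - 2 * x *
    v ^ 4 * y ^ 6 * q ^ 3 + 2 * x * v ^ 5 * y ^ 3 * q ^ 5 - 2 * x ^ 2 * w ^ 4 * q ^ 8 + x ^ 2 * v *
    y ^ 5 * w ^ 2 * q ^ 4 - x ^ 2 * v ^ 3 * y ^ 7 * q ^ 2 - 2 * x ^ 3 * y ^ 2 * w ^ 3 * q ^ 6 +
    x ^ 3 * v * y ^ 7 * w * q ^ 2 - 11 * x ^ 3 * v ^ 2 * w ^ 2 * q ^ 7 + 11 * x ^ 3 * v ^ 4 * y ^ 2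
    * q ^ 5 - 2 * x ^ 4 * w ^ 3 * q ^ 7 - 2 * x ^ 4 * v * y ^ 5 * w * q ^ 3 + 2 * x ^ 4 * v ^ 4 *
    q ^ 6 - 2 * x ^ 5 * y ^ 2 * w ^ 2 * q ^ 5 - x ^ 5 * y ^ 6 * w * q ^ 2 - x ^ 5 * v * y ^ 3 * w *
    q ^ 4 - x ^ 6 * w ^ 2 * q ^ 6 + x ^ 6 * y ^ 8 + 21 * x ^ 6 * v * y * w * q ^ 5 - x ^ 7 * y ^ 2 *
    w * q ^ 4 + 3 * v * w ^ 3 * q ^ 8 - 2 * v * y ^ 4 * w ^ 2 * q ^ 5 + v * y ^ 8 * w * q ^ 2 - 2 *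
    v ^ 2 * y * w ^ 2 * q ^ 7 - 2 * v ^ 3 * y ^ 6 * q ^ 3 + 2 * v ^ 4 * y ^ 3 * q ^ 5 + x * y ^ 5 *
    w ^ 2 * q ^ 4 + 24 * x * v * y ^ 6 * w * q ^ 3 - x * v ^ 2 * y ^ 7 * q ^ 2 - 2 * x * v ^ 3 *
    y ^ 4 * q ^ 4 + 22 * x * v ^ 4 * y * q ^ 6 + x ^ 2 * y ^ 7 * w * q ^ 2 - 10 * x ^ 2 * v * w ^ 2
    * q ^ 7 + x ^ 2 * v * y ^ 4 * w * q ^ 4 + 11 * x ^ 2 * v ^ 3 * y ^ 2 * q ^ 5 - 2 * x ^ 3 * y ^ 5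
    * w * q ^ 3 + x ^ 3 * y ^ 9 + x ^ 3 * v * y ^ 2 * w * q ^ 5 + 2 * x ^ 3 * v ^ 3 * q ^ 6 - x ^ 4
    * y ^ 3 * w * q ^ 4 + 22 * x ^ 4 * v * w * q ^ 6 + 21 * x ^ 5 * y * w * q ^ 5 - x ^ 5 * y ^ 5 *
    q ^ 2 - x ^ 6 * y ^ 3 * q ^ 3 + 2 * y ^ 2 * w ^ 2 * q ^ 6 + 24 * y ^ 6 * w * q ^ 3 + y ^ 10 - v
    * y ^ 7 * q ^ 2 - 2 * v ^ 2 * y ^ 4 * q ^ 4 + 22 * v ^ 3 * y * q ^ 6 - 10 * x * w ^ 2 * q ^ 7 +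
    x * y ^ 4 * w * q ^ 4 + 2 * x * y ^ 8 * q - 238 * x * v * y * w * q ^ 6 - 2 * x * v * y ^ 5 *
    q ^ 3 + 10 * x * v ^ 2 * y ^ 2 * q ^ 5 + 2 * x ^ 2 * y ^ 2 * w * q ^ 5 + x ^ 2 * y ^ 6 * q ^ 2 +
    2 * x ^ 2 * v ^ 2 * q ^ 6 + 22 * x ^ 3 * w * q ^ 6 + x ^ 3 * y ^ 4 * q ^ 3 - 238 * y * w * q ^ 6
    - 2 * y ^ 5 * q ^ 3 + 10 * v * y ^ 2 * q ^ 5 + 3 * x * y ^ 3 * q ^ 4 + 2 * x * v * q ^ 6 + 2 *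
    q ^ 6) * hxv +
    (-v ^ 8 * y * w ^ 5 * q ^ 10 - v ^ 5 * y * w ^ 6 * q ^ 10 - v ^ 8 * w ^ 4 * q ^ 10 - v ^ 2 * y
      * w ^ 7 * q ^ 10 - 2 * v ^ 5 * w ^ 5 * q ^ 10 - v ^ 9 * y ^ 4 * w * q ^ 6 - x ^ 9 * y * w ^ 4
      * q ^ 6 + 2 * v ^ 3 * y * w ^ 5 * q ^ 9 + v ^ 7 * y * w ^ 2 * q ^ 8 - v ^ 9 * y ^ 3 * q ^ 6 +
      v ^ 10 * q ^ 8 + x * w ^ 7 * q ^ 10 + 2 * x ^ 5 * w ^ 5 * q ^ 8 - 2 * x ^ 7 * w ^ 4 * q ^ 7 -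
      x ^ 9 * w ^ 3 * q ^ 6 + 4 * v ^ 3 * w ^ 4 * q ^ 9 - v ^ 4 * y * w ^ 3 * q ^ 8 + 2 * v ^ 7 *
      y ^ 4 * q ^ 5 - 3 * v ^ 8 * y * q ^ 7 + 11 * x ^ 4 * y * w ^ 4 * q ^ 7 - x ^ 8 * y ^ 5 * w *
      q ^ 2 - 24 * w ^ 5 * q ^ 9 + 2 * y ^ 4 * w ^ 4 * q ^ 6 + v * y * w ^ 4 * q ^ 8 - 2 * v ^ 4 *
      w ^ 2 * q ^ 8 - 11 * v ^ 4 * y ^ 4 * w * q ^ 5 + 3 * v ^ 5 * y * w * q ^ 7 + 2 * v ^ 5 * y ^ 5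
      * q ^ 4 + 2 * v ^ 6 * y ^ 2 * q ^ 6 + 22 * x ^ 2 * w ^ 4 * q ^ 8 + 9 * x ^ 4 * w ^ 3 * q ^ 7 -
      x ^ 5 * y ^ 6 * w * q ^ 2 + 2 * x ^ 6 * w ^ 2 * q ^ 6 + x ^ 7 * y ^ 2 * w * q ^ 4 + 3 * x ^ 8
      * w * q ^ 5 - x ^ 8 * y ^ 4 * q ^ 2 + x ^ 10 * q ^ 4 + 2 * y ^ 3 * w ^ 3 * q ^ 6 + 2 * v *
      w ^ 3 * q ^ 8 - 2 * v ^ 3 * y ^ 2 * w * q ^ 6 - 9 * v ^ 4 * y ^ 3 * q ^ 5 - 17 * v ^ 5 * q ^ 7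
      + 2 * x * y * w ^ 3 * q ^ 7 - x ^ 2 * y ^ 7 * w * q ^ 2 - 2 * x ^ 3 * y * w ^ 2 * q ^ 6 - 2 *
      x ^ 3 * y ^ 5 * w * q ^ 3 - x ^ 4 * y ^ 3 * w * q ^ 4 - 3 * x ^ 5 * y * w * q ^ 5 - 2 * x ^ 5
      * y ^ 5 * q ^ 2 + 2 * y ^ 2 * w ^ 2 * q ^ 6 - 2 * v * y ^ 3 * w * q ^ 5 + v * y ^ 7 * q ^ 2 -
      2 * v ^ 2 * w * q ^ 7 + 22 * v ^ 2 * y ^ 4 * q ^ 4 - 5 * v ^ 3 * y * q ^ 6 + 2 * x * w ^ 2 *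
      q ^ 7 + x * y ^ 4 * w * q ^ 4 - 5 * x ^ 3 * w * q ^ 6 - 4 * x ^ 3 * y ^ 4 * q ^ 3 - 2 * x ^ 4
      * y ^ 2 * q ^ 4 + 17 * x ^ 5 * q ^ 5 + 4 * y * w * q ^ 6 + 24 * y ^ 5 * q ^ 3 - 2 * v * y ^ 2
      * q ^ 5 + 2 * x * y ^ 3 * q ^ 4 + 2 * x ^ 2 * y * q ^ 5 - 234 * q ^ 6) * hyw

/-- The modular equation between `rrSeries` and its image under `X ↦ X ^ 3`. -/
theorem rrSeries_relation :
    rrSeries ^ 2 * expand3 rrSeries - X ^ 2 * rrInv ^ 2 * expand3 rrInv -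
      rrInv * expand3 rrSeries ^ 2 + X ^ 2 * rrSeries * expand3 rrInv ^ 2 - 3 * X = 0 := by
  have hc : coreSeries = partitionSeries * expand3 (pentagonalSeries ℤ) ^ 3 := by
    linear_combination (-partitionSeries) * expand3_pentagonalSeries_cube -
      coreSeries * pentagonalSeries_mul_partitionSeries
  have h := sect_three_coreSeries
  have hyw := congrArg expand3 rrSeries_mul_rrInv
  rw [map_mul, map_one] at hyw
  obtain ⟨i0, i1, i2, i3, i4⟩ := sect_partitionSeries
  obtain ⟨e0, e1, e2, e3, e4⟩ := sect_expand3_pentagonalSeries_cube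
  rw [hc, sect_three_mul, i0, i1, i2, i3, i4, e0, e1, e2, e3, e4, map_mul, map_pow,
    expand5_expand3, ← sectUnit_mul_rrNorm, rrNorm] at h
  have hC := core_dissection_eq (q := X) rrSeries_mul_rrInv hyw
  have hU : sectUnit ≠ 0 := by
    intro h0
    have := expand5_mul_sectUnit_mul_rrNorm
    rw [h0, mul_zero, zero_mul] at this
    exact zero_ne_one this
  have hE : expand3 (expand5 (pentagonalSeries ℤ)) ≠ 0 := by
    intro h0
    have := congrArg expand3 expand5_pentagonalSeries_mul
    rw [map_mul, h0, zero_mul, map_one] at this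
    exact zero_ne_one this
  have hz := mul_ne_zero hU (pow_ne_zero 3 hE)
  -- The second factor has constant term -3 R(0)³, nonzero because R is invertible.
  refine (mul_eq_zero.1 (hC.symm.trans (mul_left_cancel₀ hz ?_))).resolve_right ?_
  · linear_combination h
  · intro h0
    have h1 := congrArg constantCoeff h0
    have h2 := congrArg constantCoeff rrSeries_mul_rrInv
    have h3 := congrArg constantCoeff hyw
    simp only [map_mul, map_add, map_sub, map_pow, map_ofNat, constantCoeff_X, map_zero, map_one,
      mul_zero, zero_mul, sub_zero, zero_sub, neg_eq_zero, ne_eq, OfNat.ofNat_ne_zero,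
      not_false_eq_true, zero_pow, zero_add] at h1 h2 h3
    have hx : constantCoeff rrSeries ≠ 0 := left_ne_zero_of_mul_eq_one h2
    have hy : constantCoeff (expand3 rrSeries) ≠ 0 := left_ne_zero_of_mul_eq_one h3
    simp [hx, hy] at h1

end Relation

/-! ### Section 1 of P P_3 modulo 25, and section 4 of P⁶ -/

section Progression

local notation "E" => pentagonalSeries ℤ
local notation "P" => partitionSeries

theorem expand3_pentagonalSeries_mul : expand3 E * expand3 P = 1 := by
  rw [← map_mul, pentagonalSeries_mul_partitionSeries, map_one]

/-- The counterpart of `sect_three_coreSeries` with the roles of X and X³ exchanged. The two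
together compute the section of G in the last step. -/
theorem sect_zero_cube_mul :
    sect 0 (E ^ 3 * expand3 P) = expand5 E ^ 3 * expand3 (expand5 P) := by
  have hyw := congrArg expand3 rrSeries_mul_rrInv
  rw [map_mul, map_one] at hyw
  obtain ⟨e0, e1, e2, e3, e4⟩ := sect_pentagonalSeries_cube
  obtain ⟨i0, i1, i2, i3, i4⟩ := sect_expand3_partitionSeries
  have h := cube_dissection_eq rrSeries_mul_rrInv hyw rrSeries_relation
  have hM := congrArg expand3 sectUnit_mul_rrNorm
  rw [rrNorm] at hM
  simp only [map_mul, map_sub, map_pow, map_ofNat, expand_X] at hM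
  rw [sect_zero_mul, e0, e1, e2, e3, e4, i0, i1, i2, i3, i4, ← hM]
  linear_combination expand5 E ^ 3 * expand3 sectUnit * h

theorem exists_sect_one_eq : ∃ W : ℤ⟦X⟧, sect 1 (P * expand3 P) =
    X ^ 2 * expand5 P * expand3 sectUnit + expand3 (expand5 P) * sectUnit +
      5 * (2 * X ^ 5 * expand5 P * expand3 (expand5 E) * expand3 sectUnit ^ 2 +
        2 * X * expand5 E * expand3 (expand5 P) * sectUnit ^ 2 -
        X ^ 3 * sectUnit * expand3 sectUnit) + 25 * W := by
  have hyw := congrArg expand3 rrSeries_mul_rrInv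
  rw [map_mul, map_one] at hyw
  obtain ⟨e0, e1, e2, e3, e4⟩ := sect_partitionSeries
  obtain ⟨i0, i1, i2, i3, i4⟩ := sect_expand3_partitionSeries
  have h := partition_dissection_eq rrSeries_mul_rrInv hyw rrSeries_relation
  have hT := quotient_norm_eq rrSeries_mul_rrInv hyw rrSeries_relation
  have h1 := sectUnit_mul_rrNorm
  have hM := expand5_mul_sectUnit_mul_rrNorm
  have h13 := congrArg expand3 h1
  have hM3 := congrArg expand3 hM
  have hEI := expand5_pentagonalSeries_mul
  have hEI3 := congrArg expand3 hEI
  rw [rrNorm] at h13 hM3 h1 hM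
  simp only [map_mul, map_sub, map_pow, map_ofNat, expand_X, map_one] at h13 hM3 h1 hM hEI3
  rw [sect_one_mul, e0, e1, e2, e3, e4, i0, i1, i2, i3, i4]
  have hX : ((X : ℤ⟦X⟧) ^ 3) ^ 2 = X ^ 6 := by ring
  rw [hX] at h13 hM3
  generalize expand3 rrSeries = y at *
  generalize expand3 rrInv = w at *
  generalize expand3 sectUnit = M3 at *
  generalize expand3 (expand5 P) = I15 at *
  generalize expand3 (expand5 E) = E15 at *
  generalize rrSeries = x at *
  generalize rrInv = v at *
  generalize sectUnit = M at *
  generalize expand5 P = I5 at *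
  generalize expand5 E = E5 at *
  generalize x ^ 5 - 11 * X - X ^ 2 * v ^ 5 = N at *
  generalize y ^ 5 - 11 * X ^ 3 - X ^ 6 * w ^ 5 = N3 at *
  generalize (x ^ 2 * y - X ^ 2 * v ^ 2 * w) ^ 2 + 2 * X * (x ^ 2 * y - X ^ 2 * v ^ 2 * w) +
    4 * X ^ 2 = T at *
  obtain ⟨W, hW⟩ : ∃ W, T * N * N3 = X ^ 4 * N ^ 2 + N3 ^ 2 + 5 * W := ⟨_, hT⟩
  have hex : ∀ {a b c : ℤ⟦X⟧}, a = b + 25 * c → ∃ c, a = b + 25 * c := fun h => ⟨_, h⟩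
  obtain ⟨U, hU⟩ := hex h
  -- The norms `N` and `N3` have inverses E5 M and E15 M3, so multiplying `hW` by M² M3² E5 E15
  -- clears them.
  obtain ⟨V, hV⟩ : ∃ V, M * M3 * T = X ^ 4 * I5 * E15 * M3 ^ 2 + E5 * I15 * M ^ 2 + 5 * V := by
    refine ⟨M ^ 2 * M3 ^ 2 * E5 * E15 * W, ?_⟩
    linear_combination M ^ 2 * M3 ^ 2 * E5 * E15 * hW - M * M3 * T * E15 * M3 * N3 * hM -
      M * M3 * T * hM3 + X ^ 4 * M3 ^ 2 * E15 * M * N * hM + X ^ 4 * M3 ^ 2 * E15 * h1 +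
      M ^ 2 * E5 * M3 * N3 * hM3 + M ^ 2 * E5 * h13
  refine ⟨M * M3 * U + 2 * X * V, ?_⟩
  linear_combination M * M3 * hU + 10 * X * hV + X ^ 2 * M3 * h1 + M * h13

theorem exists_sect_four_partitionSeries_pow_six : ∃ H K : ℤ⟦X⟧, sect 4 (P ^ 6) = 5 * H ∧
    H = expand5 P ^ 4 * sectUnit * (sectUnit + expand5 E * sect 3 (P ^ 2) +
      3 * expand5 E ^ 2 * sect 2 (P ^ 3)) + 5 * K := by
  -- E satisfies a quintic equation over series in X^5 (`hquint`), with middle coefficients 5, 15,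
  -- 25, 25. Multiplied by P⁶ it expresses P⁶ through P, ..., P⁵; as section 4 of P is 5 times
  -- `sectUnit`, section 4 of P⁶ acquires a factor 5.
  have hq : P + X * (expand5 (expand5 E * 5) * P ^ 2) + X * (X * (expand5 (15 * expand5 E ^ 2) *
      P ^ 3)) + X * (X * (X * (expand5 (25 * expand5 E ^ 3) * P ^ 4))) +
      X * (X * (X * (X * (expand5 (25 * expand5 E ^ 4) * P ^ 5)))) =
      expand5 (expand5 E ^ 5 * rrNorm) * P ^ 6 := by
    have hE := pentagonalSeries_eq_dissection
    have hI := pentagonalSeries_mul_partitionSeries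
    have hxv := congrArg expand5 rrSeries_mul_rrInv
    rw [rrNorm]
    simp only [map_mul, map_sub, map_pow, map_ofNat, expand_X, map_one] at hxv ⊢
    generalize expand5 rrSeries = x at *
    generalize expand5 rrInv = v at *
    generalize expand5 (expand5 E) = F at *
    have hs : (x - X - X ^ 2 * v) ^ 5 + 5 * X * (x - X - X ^ 2 * v) ^ 4 +
        15 * X ^ 2 * (x - X - X ^ 2 * v) ^ 3 + 25 * X ^ 3 * (x - X - X ^ 2 * v) ^ 2 +
        25 * X ^ 4 * (x - X - X ^ 2 * v) = x ^ 5 - 11 * X ^ 5 - (X ^ 5) ^ 2 * v ^ 5 := by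
      linear_combination (-(5 * X ^ 2 * (x - X ^ 2 * v) ^ 3) -
        5 * X ^ 4 * (x - X ^ 2 * v) * (1 + x * v)) * hxv
    have hquint : E ^ 5 + 5 * X * F * E ^ 4 + 15 * X ^ 2 * F ^ 2 * E ^ 3 +
        25 * X ^ 3 * F ^ 3 * E ^ 2 + 25 * X ^ 4 * F ^ 4 * E =
        F ^ 5 * (x ^ 5 - 11 * X ^ 5 - (X ^ 5) ^ 2 * v ^ 5) := by
      rw [hE]
      linear_combination F ^ 5 * hs
    have p2 : E ^ 2 * P ^ 2 = 1 := by rw [← mul_pow, hI, one_pow]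
    have p3 : E ^ 3 * P ^ 3 = 1 := by rw [← mul_pow, hI, one_pow]
    have p4 : E ^ 4 * P ^ 4 = 1 := by rw [← mul_pow, hI, one_pow]
    have p5 : E ^ 5 * P ^ 5 = 1 := by rw [← mul_pow, hI, one_pow]
    linear_combination P ^ 6 * hquint - P * p5 - 5 * X * F * P ^ 2 * p4 -
      15 * X ^ 2 * F ^ 2 * P ^ 3 * p3 - 25 * X ^ 3 * F ^ 3 * P ^ 4 * p2 -
      25 * X ^ 4 * F ^ 4 * P ^ 5 * hI
  have h := congrArg (sect 4) hq
  simp only [map_add, sect_expand5_mul (show 4 < 5 by norm_num), sect_four_X_mul,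
    sect_expand5_mul (show 3 < 5 by norm_num), sect_three_X_mul,
    sect_expand5_mul (show 2 < 5 by norm_num), sect_two_X_mul,
    sect_expand5_mul (show 1 < 5 by norm_num), sect_one_X_mul,
    sect_expand5_mul (show 0 < 5 by norm_num), sect_partitionSeries.2.2.2.2] at h
  refine ⟨_, expand5 P ^ 4 * sectUnit * (expand5 E ^ 3 * sect 1 (P ^ 4) +
    expand5 E ^ 4 * sect 0 (P ^ 5)), ?_, rfl⟩
  have hM := expand5_mul_sectUnit_mul_rrNorm
  have hEI : expand5 E ^ 4 * expand5 P ^ 4 = 1 := by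
    rw [← mul_pow, expand5_pentagonalSeries_mul, one_pow]
  linear_combination (-(expand5 P ^ 4 * sectUnit)) * h -
    sect 4 (P ^ 6) * expand5 E ^ 4 * expand5 P ^ 4 * hM - sect 4 (P ^ 6) * hEI

end Progression

/-! ### The two congruences -/

section Congruences

local notation "E" => pentagonalSeries ℤ
local notation "P" => partitionSeries

theorem sect_four_X_sq_mul {R : Type*} [CommRing R] (f : R⟦X⟧) :
    sect 4 (X ^ 2 * f) = sect 2 f := by
  rw [pow_two, mul_assoc, sect_four_X_mul, sect_three_X_mul]

/-- Both leading terms of section 1 are P⁶, or its image under X ↦ X³, times a series in X^5 up to a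
power of X. Taking section 4 therefore reaches section 4 of P⁶, which is 5H. -/
theorem exists_sect_four_sect_one_eq : ∃ G H K W : ℤ⟦X⟧,
    sect 4 (sect 1 (P * expand3 P)) = 5 * G ∧
    G = X ^ 2 * P * expand3 E ^ 5 * expand3 H + expand3 P * E ^ 5 * H +
      sect 4 (2 * X ^ 5 * expand5 P * expand3 (expand5 E) * expand3 sectUnit ^ 2 +
        2 * X * expand5 E * expand3 (expand5 P) * sectUnit ^ 2 -
        X ^ 3 * sectUnit * expand3 sectUnit) + 5 * W ∧
    H = expand5 P ^ 4 * sectUnit * (sectUnit + expand5 E * sect 3 (P ^ 2) +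
      3 * expand5 E ^ 2 * sect 2 (P ^ 3)) + 5 * K := by
  obtain ⟨W, hW⟩ := exists_sect_one_eq
  obtain ⟨H, K, hH, hK⟩ := exists_sect_four_partitionSeries_pow_six
  refine ⟨_, H, K, sect 4 W, ?_, rfl, hK⟩
  have h1 : X ^ 2 * expand5 P * expand3 sectUnit =
      expand5 (P * expand3 E ^ 5) * (X ^ 2 * expand3 (P ^ 6)) := by
    rw [sectUnit]
    simp only [map_mul, map_pow, expand5_expand3]
    ring
  have h2 : expand3 (expand5 P) * sectUnit = expand5 (expand3 P * E ^ 5) * P ^ 6 := by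
    rw [sectUnit]
    simp only [map_mul, map_pow, expand5_expand3]
    ring
  have h5 : ∀ f : ℤ⟦X⟧, sect 4 (5 * f) = 5 * sect 4 f := fun f => by
    simpa only [nsmul_eq_mul, Nat.cast_ofNat] using map_nsmul (sect 4) 5 f
  have h25 : ∀ f : ℤ⟦X⟧, sect 4 (25 * f) = 25 * sect 4 f := fun f => by
    simpa only [nsmul_eq_mul, Nat.cast_ofNat] using map_nsmul (sect 4) 25 f
  rw [hW, map_add, map_add, map_add, h5, h25, h1, h2, sect_expand5_mul (by norm_num),
    sect_expand5_mul (by norm_num), sect_four_X_sq_mul, sect_two_expand3, hH, map_mul, map_ofNat]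
  ring

/-- The computation modulo 5, with e, i, e3, i3 in the roles of E, P, E_3, P_3. As f(X^5) = f^5,
every fifth power leaves a section as its base, so only exponents modulo 5 matter. -/
theorem reduction_eq {e i e3 i3 : (ZMod 5)⟦X⟧}
    (h3 : expand3 e = e3) (h3i : expand3 i = i3)
    (hei : e * i = 1) (hei3 : e3 * i3 = 1)
    (hi4 : sect 4 i = 0) (he3 : sect 3 (e ^ 3) = 0) (he2 : sect 2 (e ^ 2) = -e ^ 10)
    (hcube : sect 0 (e ^ 3 * i3) = e ^ 15 * i3 ^ 5)
    (hcore : sect 3 (e3 ^ 3 * i) = X * (e3 ^ 15 * i ^ 5))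
    (hone : sect 1 (i * i3) = X ^ 2 * i ^ 5 * e3 ^ 19 + i3 ^ 5 * e ^ 19)
    {G H : (ZMod 5)⟦X⟧}
    (hH : H = (i ^ 5) ^ 4 * e ^ 19 * (e ^ 19 + e ^ 5 * sect 3 (i ^ 2) +
      3 * (e ^ 5) ^ 2 * sect 2 (i ^ 3)))
    (hG : G = X ^ 2 * i * e3 ^ 5 * expand3 H + i3 * e ^ 5 * H +
      sect 4 (2 * X ^ 5 * i ^ 5 * e3 ^ 5 * (e3 ^ 19) ^ 2 + 2 * X * e ^ 5 * i3 ^ 5 * (e ^ 19) ^ 2 -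
        X ^ 3 * e ^ 19 * e3 ^ 19)) :
    sect 4 (sect 0 G) = 0 := by
  have five : (5 : (ZMod 5)⟦X⟧) = 0 := by
    rw [← map_ofNat (C : ZMod 5 →+* _) 5, show (OfNat.ofNat 5 : ZMod 5) = 0 from rfl, map_zero]
  have s : ∀ {r : ℕ}, r < 5 → ∀ f g : (ZMod 5)⟦X⟧, sect r (f ^ 5 * g) = f * sect r g :=
    fun hr f g => by rw [← expand5_zmod, sect_expand5_mul hr]
  have hp : ∀ k, e ^ k * i ^ k = 1 := fun k => by rw [← mul_pow, hei, one_pow]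
  have hp3 : ∀ k, e3 ^ k * i3 ^ k = 1 := fun k => by rw [← mul_pow, hei3, one_pow]
  have a1 : sect 3 (i ^ 2) = 0 := by
    rw [show i ^ 2 = i ^ 5 * e ^ 3 by linear_combination (-i ^ 2) * hp 3, s (by norm_num), he3,
      mul_zero]
  have a2 : sect 2 (i ^ 3) = -(i * e ^ 10) := by
    rw [show i ^ 3 = i ^ 5 * e ^ 2 by linear_combination (-i ^ 3) * hp 2, s (by norm_num), he2]
    ring
  have hH' : H = -2 * e ^ 18 := by
    rw [hH, a1, a2]
    linear_combination (e ^ 18 - 3 * e ^ 10 * i * e ^ 9) * hp 20 - 3 * e ^ 18 * hei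
  have h3H : expand3 H = -2 * e3 ^ 18 := by
    rw [hH', map_mul, map_neg, map_ofNat, map_pow, h3]
  have he33 : sect 4 (e3 ^ 3) = 0 := by
    rw [← h3, ← map_pow, sect_four_expand3, he3, map_zero, mul_zero]
  have b1 : sect 4 (2 * X ^ 5 * i ^ 5 * e3 ^ 5 * (e3 ^ 19) ^ 2) = 0 := by
    rw [show 2 * X ^ 5 * i ^ 5 * e3 ^ 5 * (e3 ^ 19) ^ 2 =
      (X * i * e3 ^ 8) ^ 5 * e3 ^ 3 + (X * i * e3 ^ 8) ^ 5 * e3 ^ 3 by ring, map_add,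
      s (by norm_num), he33, mul_zero, add_zero]
  have b2 : sect 4 (2 * X * e ^ 5 * i3 ^ 5 * (e ^ 19) ^ 2) = 0 := by
    rw [show 2 * X * e ^ 5 * i3 ^ 5 * (e ^ 19) ^ 2 =
      X * ((i3 * e ^ 8) ^ 5 * e ^ 3) + X * ((i3 * e ^ 8) ^ 5 * e ^ 3) by ring, map_add,
      sect_four_X_mul, s (by norm_num), he3, mul_zero, add_zero]
  have b3 : sect 4 (X ^ 3 * e ^ 19 * e3 ^ 19) =
      (e * e3) ^ 4 * (X ^ 2 * i ^ 5 * e3 ^ 19 + i3 ^ 5 * e ^ 19) := by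
    rw [show X ^ 3 * e ^ 19 * e3 ^ 19 = X ^ 2 * (X * (((e * e3) ^ 4) ^ 5 * (i * i3))) by
      linear_combination (-(X ^ 3 * e ^ 19 * e3 ^ 19)) * (hei * e3 * i3 + hei3),
      sect_four_X_sq_mul, sect_two_X_mul, s (by norm_num), hone]
  -- Each term gets -2 from H and -1 from `b3`, and -3 = 2 modulo 5.
  have hG' : G = 2 * (X ^ 2 * e3 ^ 23 * i + e ^ 23 * i3) := by
    rw [hG, map_sub, map_add, b1, b2, b3, h3H, hH']
    linear_combination (-(X ^ 2 * i * e3 ^ 23)) * hp 4 - e ^ 23 * i3 * hp3 4 -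
      (X ^ 2 * e3 ^ 23 * i + e ^ 23 * i3) * five
  -- `c1` and `c2` turn the two terms of G into the two terms of `hone`, so section 0 of G is again
  -- a multiple of section 1 of i i3.
  have c1 : sect 0 (X ^ 2 * e3 ^ 23 * i) = X ^ 2 * e3 ^ 19 * i ^ 5 := by
    rw [show X ^ 2 * e3 ^ 23 * i = X * (X * ((e3 ^ 4) ^ 5 * (e3 ^ 3 * i))) by ring,
      sect_zero_X_mul, sect_four_X_mul, s (by norm_num), hcore]
    ring
  have c2 : sect 0 (e ^ 23 * i3) = e ^ 19 * i3 ^ 5 := by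
    rw [show e ^ 23 * i3 = (e ^ 4) ^ 5 * (e ^ 3 * i3) by ring, s (by norm_num), hcube]
    ring
  have d1 : sect 4 (X ^ 2 * e3 ^ 19 * i ^ 5) = 0 := by
    rw [show X ^ 2 * e3 ^ 19 * i ^ 5 = X ^ 2 * ((e3 ^ 4 * i) ^ 5 * i3) by
      linear_combination (-(X ^ 2 * e3 ^ 19 * i ^ 5)) * hei3,
      sect_four_X_sq_mul, s (by norm_num), ← h3i, sect_two_expand3, hi4, map_zero, mul_zero,
      mul_zero]
  have d2 : sect 4 (e ^ 19 * i3 ^ 5) = 0 := by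
    rw [show e ^ 19 * i3 ^ 5 = (e ^ 4 * i3) ^ 5 * i by
      linear_combination (-(e ^ 19 * i3 ^ 5)) * hei, s (by norm_num), hi4, mul_zero]
  rw [hG', two_mul, map_add, map_add, map_add, c1, c2, map_add, d1, d2]
  simp

theorem five_dvd_of_map_eq_zero {f : ℤ⟦X⟧} (h : map (Int.castRingHom (ZMod 5)) f = 0) (n : ℕ) :
    (5 : ℤ) ∣ coeff n f := by
  have h1 := congrArg (coeff n) h
  rw [coeff_map, map_zero] at h1
  exact (ZMod.intCast_zmod_eq_zero_iff_dvd _ 5).1 h1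

theorem exists_sect_four_sect_one_eq_five_mul : ∃ G : ℤ⟦X⟧,
    sect 4 (sect 1 (P * expand3 P)) = 5 * G ∧
    map (Int.castRingHom (ZMod 5)) (sect 4 (sect 0 G)) = 0 := by
  obtain ⟨G, H, K, W, hG5, hG, hH⟩ := exists_sect_four_sect_one_eq
  refine ⟨G, hG5, ?_⟩
  obtain ⟨V, hV⟩ := exists_sect_one_eq
  have hcoreE : coreSeries = expand3 E ^ 3 * P := by
    linear_combination (-P) * expand3_pentagonalSeries_cube -
      coreSeries * pentagonalSeries_mul_partitionSeries
  have hcore := sect_three_coreSeries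
  have hcube := sect_zero_cube_mul
  have hei := pentagonalSeries_mul_partitionSeries
  have hei3 := expand3_pentagonalSeries_mul
  have hi4 := sect_partitionSeries.2.2.2.2
  have he3 := sect_pentagonalSeries_cube.2.2.2.1
  have he2 := sect_two_pentagonalSeries_sq
  rw [hcoreE] at hcore
  have five : (5 : (ZMod 5)⟦X⟧) = 0 := by
    rw [← map_ofNat (C : ZMod 5 →+* _) 5, show (OfNat.ofNat 5 : ZMod 5) = 0 from rfl, map_zero]
  have t5 : (25 : (ZMod 5)⟦X⟧) = 0 := by linear_combination 5 * five
  set π := map (Int.castRingHom (ZMod 5)) with hπ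
  have hU : π sectUnit = π E ^ 19 := by
    have h := congrArg π hei
    rw [map_mul, map_one] at h
    rw [sectUnit, map_mul, map_pow, map_pow, map_expand, expand5_zmod]
    have h6 := congrArg (· ^ 6) h
    simp only [mul_pow, one_pow] at h6
    linear_combination π E ^ 19 * h6
  replace hcore := congrArg π hcore
  replace hcube := congrArg π hcube
  replace hei := congrArg π hei
  replace hei3 := congrArg π hei3
  replace hi4 := congrArg π hi4
  replace he3 := congrArg π he3
  replace he2 := congrArg π he2
  replace hV := congrArg π hV
  replace hG := congrArg π hG
  replace hH := congrArg π hH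
  simp only [hπ, ← sect_map, map_mul, map_add, map_sub, map_neg, map_pow, map_expand, map_ofNat,
    map_X, map_one, expand5_zmod, five, t5, zero_mul, mul_zero, add_zero] at hcore hcube hei hei3 hi4 he3 he2 hV hG hH hU ⊢
  simp only [hU, map_pow] at hV hG hH
  refine reduction_eq rfl rfl hei hei3 hi4 he3 (he2.trans ?_) (hcube.trans ?_) (hcore.trans ?_)
    hV hH (hG.trans ?_)
  · ring
  · ring
  · ring
  · rw [map_sub, map_add]

end Congruences

theorem corollary2 :
    (∀ n : ℕ, pOneThree (25 * n + 21) ≡ 0 [MOD 5]) ∧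
      (∀ n : ℕ, pOneThree (625 * n + 521) ≡ 0 [MOD 5 ^ 2]) := by
  obtain ⟨G, hG, hG0⟩ := exists_sect_four_sect_one_eq_five_mul
  have hp : (mk fun n => (pOneThree n : ℤ)) = partitionSeries * expand3 partitionSeries :=
    mk_pOneThree_eq
  have key : ∀ n, (pOneThree (25 * n + 21) : ℤ) = 5 * coeff n G := by
    intro n
    have h := congrArg (coeff n) hG
    rw [← hp, coeff_sect, coeff_sect, coeff_mk, ← map_ofNat (C : ℤ →+* ℤ⟦X⟧) 5, coeff_C_mul] at h
    rw [show 25 * n + 21 = 5 * (5 * n + 4) + 1 by ring]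
    exact h
  refine ⟨fun n => ?_, fun n => ?_⟩
  · rw [Nat.modEq_zero_iff_dvd]
    have : (5 : ℤ) ∣ pOneThree (25 * n + 21) := ⟨_, key n⟩
    exact_mod_cast this
  · rw [Nat.modEq_zero_iff_dvd]
    have h := five_dvd_of_map_eq_zero hG0 n
    rw [coeff_sect, coeff_sect] at h
    -- The index of section 4 of section 0 of G; 25(25n + 20) + 21 = 625n + 521.
    have h2 := key (5 * (5 * n + 4) + 0)
    rw [show 25 * (5 * (5 * n + 4) + 0) + 21 = 625 * n + 521 by ring] at h2
    have : ((5 ^ 2 : ℕ) : ℤ) ∣ pOneThree (625 * n + 521) := by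
      rw [h2]
      obtain ⟨c, hc⟩ := h
      exact ⟨c, by rw [hc]; push_cast; ring⟩
    exact_mod_cast this
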